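/- **Setting.** For integers $k\ge 1$ and $n\ne 0$ let $G_{k,n}=\langle a,b\mid w^n a=b w^n\rangle$ be the knot group of the double twist knot $J(k,2n)$, where $w=(ba^{-1})^m(b^{-1}a)^m$ if $k=2m$ and $w=(ba^{-1})^m\,ba\,(b^{-1}a)^m$ if $k=2m+1$. The generators $a,b$ are meridians, and the abelianization $\mathfrak a:G_{k,n}\to\langle t\rangle\cong\mathbb Z$ sends both to $t$. Put $r=w^n a w^{-n} b^{-1}$. For a representation $\rho:G_{k,n}\to \mathrm{SL}_2(\mathbb C)$ let $\mathrm{Ad}(V)(g)=VgV^{-1}$ be the adjoint action of $\mathrm{SL}_2(\mathbb C)$ on $\mathfrak{sl}_2(\mathbb C)\cong\mathbb C^3$, and let $\Phi:\mathbb Z[F(a,b)]\to M_3(\mathbb C[t^{\pm1}])$ be the ring homomorphism with $\Phi(g)=\mathfrak a(g)\,\mathrm{Ad}(\rho(g))$ for $g\in F(a,b)$. The adjoint twisted Alexander polynomial is the rational function $$\Delta^{\mathrm{Ad}\circ\rho}_{J(k,2n)}(t)=\frac{\det\Phi\left(\partial r/\partial a\right)}{\det\Phi(1-b)}\in\mathbb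 C(t),$$ where $\partial/\partial a$ is the Fox derivative. Put $y=\operatorname{tr}\rho(ab^{-1})$ and $z=\operatorname{tr}\rho(w)$, and let $S_l$ ($l\in\mathbb Z$) be the Chebyshev polynomials with $S_0(v)=1$, $S_1(v)=v$, $S_l(v)=vS_{l-1}(v)-S_{l-2}(v)$. **Proposition 3.6.** Let $n\ge 1$, and let $\rho_0:G_{k,n}\to\mathrm{SL}_2(\mathbb C)$ be a holonomy representation of $J(k,2n)$, i.e. a lift of a discrete and faithful representation $G_{k,n}\to\mathrm{PSL}_2(\mathbb C)$; or, more generally (so that the non-hyperbolic knots are covered too), let $\rho_0$ be either such a lift or a representation with nonabelian image and $\operatorname{tr}\rho_0(a)=\pm2$. Then in each of the following cases $\Delta^{\mathrm{Ad}\circ\rho_0}_{J(k,2n)}(t)$ is a Laurent polynomial, whose highest and lowest degree terms (with nonzero coefficients) are the two terms displayed: 1. if $k=2m$ with $m\ge1$, $$\Delta^{\mathrm{Ad}\circ\rho_0}_{J(k,2n)}(t)=-mn\,S_{m-1}(y)^2S_{n-1}(z)^2\,t^0+\cdots+mn\,S_{m-1}(y)^2S_{n-1}(z)^2\,t^{-3};$$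 2. if $k=2m+1\ge3$, $$\Delta^{\mathrm{Ad}\circ\rho_0}_{J(k,2n)}(t)=m\,S_{m-1}(y)^2\,t^{6n-3}+\cdots-m\,S_{m-1}(y)^2\,t^{0};$$ 3. if $k=1$ and $n\ge2$, $$\Delta^{\mathrm{Ad}\circ\rho_0}_{J(k,2n)}(t)=-t^{6n-6}+\cdots+t^{3}.$$ -/

import Mathlib

open scoped LaurentPolynomial MatrixGroups

noncomputable section

namespace DoubleTwist

/-! ### Fox calculus on a free group -/

/-- The integral group ring of the free group on `α`. -/
abbrev FreeRing (α : Type) : Type := MonoidAlgebra ℤ (FreeGroup α)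

/-- The Fox derivative with respect to the generator `j`, computed on a word in the letters
`x_i` (the pair `(i, true)`) and `x_i⁻¹` (the pair `(i, false)`). -/
def foxWord {α : Type} [DecidableEq α] (j : α) : List (α × Bool) → FreeRing α
  | [] => 0
  | (i, true) :: L =>
      (if i = j then 1 else 0) + MonoidAlgebra.of ℤ _ (FreeGroup.of i) * foxWord j L
  | (i, false) :: L =>
      MonoidAlgebra.of ℤ _ (FreeGroup.of i)⁻¹ * (foxWord j L - if i = j then 1 else 0)

/-- The Fox derivative `∂g/∂x_j` of an element `g` of the free group. -/
def fox {α : Type} [DecidableEq α] (j : α) (g : FreeGroup α) : FreeRing α :=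
  foxWord j g.toWord

theorem foxWord_append {α : Type} [DecidableEq α] (j : α) (L M : List (α × Bool)) :
    foxWord j (L ++ M) =
      foxWord j L + MonoidAlgebra.of ℤ _ (FreeGroup.mk L) * foxWord j M := by
  induction L with
  | nil =>
    rw [List.nil_append, ← FreeGroup.one_eq_mk, map_one]
    simp [foxWord]
  | cons p L ih =>
    obtain ⟨i, s⟩ := p
    have h : (FreeGroup.mk ((i, s) :: L) : FreeGroup α)
        = FreeGroup.mk [(i, s)] * FreeGroup.mk L := by
      rw [FreeGroup.mul_mk]; rfl
    cases s with
    | true =>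
      have h1 : (FreeGroup.mk [(i, true)] : FreeGroup α) = FreeGroup.of i := rfl
      rw [h, h1, map_mul, List.cons_append]
      simp only [foxWord, ih, mul_add, mul_assoc, add_assoc]
    | false =>
      have h1 : (FreeGroup.mk [(i, false)] : FreeGroup α) = (FreeGroup.of i)⁻¹ := rfl
      rw [h, h1, map_mul, List.cons_append]
      simp only [foxWord, ih, mul_add, mul_sub, mul_assoc]
      abel

theorem foxWord_step {α : Type} [DecidableEq α] (j : α) {L M : List (α × Bool)}
    (h : FreeGroup.Red.Step L M) : foxWord j L = foxWord j M := by
  cases h with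
  | @not L₁ L₂ x b =>
    rw [foxWord_append, foxWord_append]
    congr 2
    cases b <;>
      simp only [foxWord, Bool.not_true, Bool.not_false, mul_sub, mul_add, ← mul_assoc,
        ← map_mul, inv_mul_cancel, mul_inv_cancel, map_one, one_mul] <;> abel

theorem foxWord_red {α : Type} [DecidableEq α] (j : α) {L M : List (α × Bool)}
    (h : FreeGroup.Red L M) : foxWord j L = foxWord j M := by
  induction h with
  | refl => rfl
  | tail _ h ih => exact ih.trans (foxWord_step j h)

/-- The product rule `∂(gh)/∂x_j = ∂g/∂x_j + g ∂h/∂x_j`. -/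
theorem fox_mul {α : Type} [DecidableEq α] (j : α) (g h : FreeGroup α) :
    fox j (g * h) = fox j g + MonoidAlgebra.of ℤ _ g * fox j h := by
  have hg : FreeGroup.mk g.toWord = g := FreeGroup.mk_toWord
  have : (g * h).toWord = FreeGroup.reduce (g.toWord ++ h.toWord) := FreeGroup.toWord_mul g h
  unfold fox
  rw [this, ← foxWord_red j FreeGroup.reduce.red, foxWord_append, hg]

/-- The rule `∂x_i/∂x_j = δ_{ij}`. -/
theorem fox_of {α : Type} [DecidableEq α] (i j : α) :
    fox j (FreeGroup.of i) = if i = j then 1 else 0 := by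
  simp [fox, foxWord]

/-! ### The group of a double twist knot -/

/-- The free group on the two meridian generators `a` and `b`. -/
abbrev F2 : Type := FreeGroup (Fin 2)

/-- The free generator `a`. -/
def fa : F2 := FreeGroup.of 0

/-- The free generator `b`. -/
def fb : F2 := FreeGroup.of 1

/-- The word `w`: it is `(ba⁻¹)^m (b⁻¹a)^m` if `k = 2m`, and `(ba⁻¹)^m ba (b⁻¹a)^m` if
`k = 2m + 1`. -/
def word (k : ℕ) : F2 :=
  (fb * fa⁻¹) ^ (k / 2) * (if Even k then 1 else fb * fa) * (fb⁻¹ * fa) ^ (k / 2)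

/-- The relator `r = wⁿ a w⁻ⁿ b⁻¹`. -/
def relator (k : ℕ) (n : ℤ) : F2 :=
  word k ^ n * fa * word k ^ (-n) * fb⁻¹

/-- The knot group of `J(k, 2n)`, in the presentation `⟨a, b | wⁿ a = b wⁿ⟩`. -/
abbrev KnotGroup (k : ℕ) (n : ℤ) : Type := PresentedGroup {relator k n}

/-- The projection of the free group onto the knot group. -/
def proj (k : ℕ) (n : ℤ) : F2 →* KnotGroup k n := PresentedGroup.mk {relator k n}

/-- The abelianization `G(K) → ℤ = ⟨t⟩`, which sends both meridians `a`, `b` to `t`. -/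
def abel (k : ℕ) (n : ℤ) : KnotGroup k n →* Multiplicative ℤ :=
  PresentedGroup.toGroup (f := fun _ => Multiplicative.ofAdd 1) (by
    intro r hr
    rw [Set.mem_singleton_iff.1 hr]
    simp [relator, fa, fb])

/-! ### The adjoint representation of `SL₂(ℂ)` -/

/-- The Lie algebra `sl₂(ℂ)` of traceless matrices. -/
abbrev sl2 : Type := LieAlgebra.SpecialLinear.sl (Fin 2) ℂ

theorem sl2_trace (X : sl2) : Matrix.trace X.1 = 0 :=
  LinearMap.mem_ker.1 X.2

theorem mem_sl2 {X : Matrix (Fin 2) (Fin 2) ℂ} (h : Matrix.trace X = 0) :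
    X ∈ LieAlgebra.SpecialLinear.sl (Fin 2) ℂ :=
  LinearMap.mem_ker.2 h

/-- The adjoint action `Ad(V)(g) = V g V⁻¹` of `SL₂(ℂ)` on `sl₂(ℂ)`. -/
def adjointAction : SL(2, ℂ) →* Module.End ℂ sl2 where
  toFun V :=
    { toFun := fun X => ⟨V.1 * X.1 * (V⁻¹).1, mem_sl2 (by
        rw [Matrix.trace_mul_comm, ← mul_assoc, ← Matrix.SpecialLinearGroup.coe_mul,
          inv_mul_cancel, Matrix.SpecialLinearGroup.coe_one, one_mul, sl2_trace])⟩
      map_add' := fun X Y => Subtype.ext (by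
        change V.1 * (X.1 + Y.1) * (V⁻¹).1 = V.1 * X.1 * (V⁻¹).1 + V.1 * Y.1 * (V⁻¹).1
        rw [mul_add, add_mul])
      map_smul' := fun c X => Subtype.ext (by
        change V.1 * (c • X.1) * (V⁻¹).1 = c • (V.1 * X.1 * (V⁻¹).1)
        rw [Matrix.mul_smul, Matrix.smul_mul]) }
  map_one' := by
    ext1 X
    apply Subtype.ext
    change (1 : SL(2, ℂ)).1 * X.1 * ((1 : SL(2, ℂ))⁻¹).1 = X.1
    rw [inv_one, Matrix.SpecialLinearGroup.coe_one, one_mul, mul_one]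
  map_mul' V W := by
    ext1 X
    apply Subtype.ext
    change (V * W).1 * X.1 * ((V * W)⁻¹).1 = V.1 * (W.1 * X.1 * (W⁻¹).1) * (V⁻¹).1
    rw [mul_inv_rev, Matrix.SpecialLinearGroup.coe_mul, Matrix.SpecialLinearGroup.coe_mul]
    simp only [mul_assoc]

/-- Coordinates on `sl₂(ℂ)`: the triple `(p, q, r)` corresponds to the matrix
`[[q, p], [r, -q]]`. -/
def sl2Equiv : sl2 ≃ₗ[ℂ] (Fin 3 → ℂ) where
  toFun X := ![X.1 0 1, X.1 0 0, X.1 1 0]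
  map_add' X Y := by
    ext i; fin_cases i <;> rfl
  map_smul' c X := by
    ext i; fin_cases i <;> rfl
  invFun v := ⟨!![v 1, v 0; v 2, - v 1], mem_sl2 (by simp [Matrix.trace_fin_two])⟩
  left_inv X := by
    have h := sl2_trace X
    rw [Matrix.trace_fin_two] at h
    apply Subtype.ext
    ext i j
    fin_cases i <;> fin_cases j
    · rfl
    · rfl
    · rfl
    · exact neg_eq_of_add_eq_zero_right h
  right_inv v := by
    ext i; fin_cases i <;> rfl

/-- The standard basis `E, H, F` of `sl₂(ℂ)`. -/
def sl2Basis : Module.Basis (Fin 3) ℂ sl2 := Module.Basis.ofEquivFun sl2Equiv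

/-- `Ad(V)` as a `3 × 3` matrix. -/
def Ad : SL(2, ℂ) →* Matrix (Fin 3) (Fin 3) ℂ :=
  (LinearMap.toMatrixAlgEquiv sl2Basis :
    Module.End ℂ sl2 ≃* Matrix (Fin 3) (Fin 3) ℂ).toMonoidHom.comp adjointAction

/-! ### The adjoint twisted Alexander polynomial -/

/-- `(Ad ∘ ρ) ⊗ 𝔞` on group elements: `g ↦ t^{𝔞(g)} Ad(ρ(g))`. -/
def tensorRep {k : ℕ} {n : ℤ} (ρ : KnotGroup k n →* SL(2, ℂ)) :
    KnotGroup k n →* Matrix (Fin 3) (Fin 3) ℂ[T;T⁻¹] where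
  toFun g := LaurentPolynomial.T (Multiplicative.toAdd (abel k n g)) •
    (Ad (ρ g)).map (LaurentPolynomial.C : ℂ →+* ℂ[T;T⁻¹])
  map_one' := by
    rw [map_one (abel k n), map_one ρ, map_one Ad, toAdd_one, LaurentPolynomial.T_zero (R := ℂ), one_smul,
      Matrix.map_one LaurentPolynomial.C (map_zero LaurentPolynomial.C) (map_one LaurentPolynomial.C)]
  map_mul' g h := by
    rw [map_mul (abel k n), map_mul ρ, map_mul Ad, toAdd_mul, LaurentPolynomial.T_add, Matrix.map_mul,
      Matrix.smul_mul, Matrix.mul_smul, smul_smul]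

/-- The ring homomorphism `Φ : ℤ[F₂] → M₃(ℂ[t, t⁻¹])`. -/
def Phi {k : ℕ} {n : ℤ} (ρ : KnotGroup k n →* SL(2, ℂ)) :
    FreeRing (Fin 2) →ₐ[ℤ] Matrix (Fin 3) (Fin 3) ℂ[T;T⁻¹] :=
  MonoidAlgebra.lift ℤ _ _ ((tensorRep ρ).comp (proj k n))

/-- The field `ℂ(t)` of rational functions, as the fraction field of `ℂ[t, t⁻¹]`. -/
abbrev RatField : Type := FractionRing ℂ[T;T⁻¹]

/-- The adjoint twisted Alexander polynomial
`Δ^{Ad ∘ ρ}(t) = det Φ(∂r/∂a) / det Φ(1 - b)`, a rational function of `t`. -/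
def adjointAlexander {k : ℕ} {n : ℤ} (ρ : KnotGroup k n →* SL(2, ℂ)) : RatField :=
  algebraMap ℂ[T;T⁻¹] RatField (Phi ρ (fox 0 (relator k n))).det /
    algebraMap ℂ[T;T⁻¹] RatField (Phi ρ (1 - MonoidAlgebra.of ℤ _ fb)).det

/-- The rational function `f` is a Laurent polynomial, with highest degree term `c t^d` and
lowest degree term `c' t^e` (so the coefficients `c` and `c'` are not zero). -/
def HasExtremeTerms (f : RatField) (d : ℤ) (c : ℂ) (e : ℤ) (c' : ℂ) : Prop :=
  ∃ P : ℂ[T;T⁻¹], f = algebraMap ℂ[T;T⁻¹] RatField P ∧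
    (P.coeff d = c ∧ c ≠ 0 ∧ ∀ i, d < i → P.coeff i = 0) ∧
    (P.coeff e = c' ∧ c' ≠ 0 ∧ ∀ i, i < e → P.coeff i = 0)

/-! ### Representations -/

/-- The representation is nonabelian: its image is a nonabelian group. -/
def IsNonabelian {G : Type} [Group G] (ρ : G →* SL(2, ℂ)) : Prop :=
  ∃ g h : G, ρ g * ρ h ≠ ρ h * ρ g

/-- The projection of `SL₂(ℂ)` onto `PSL₂(ℂ) = Isom⁺(ℍ³)`. -/
def toPSL : SL(2, ℂ) →* Matrix.ProjectiveSpecialLinearGroup (Fin 2) ℂ :=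
  QuotientGroup.mk' (Subgroup.center SL(2, ℂ))

/-- `ρ` is a lift to `SL₂(ℂ)` of a discrete and faithful representation into `PSL₂(ℂ)`, that is,
a lift of the holonomy representation of a hyperbolic knot. -/
def IsHolonomyLift {G : Type} [Group G] (ρ : G →* SL(2, ℂ)) : Prop :=
  Function.Injective (toPSL.comp ρ) ∧ DiscreteTopology (toPSL.comp ρ).range

/-- `ρ` is nonabelian and the trace of the meridian `a` is `2` or `-2`. -/
def IsParabolic {k : ℕ} {n : ℤ} (ρ : KnotGroup k n →* SL(2, ℂ)) : Prop :=
  IsNonabelian ρ ∧ ((ρ (proj k n fa)).1.trace = 2 ∨ (ρ (proj k n fa)).1.trace = -2)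

/-- The trace `y = tr ρ(ab⁻¹)`. -/
def trY {k : ℕ} {n : ℤ} (ρ : KnotGroup k n →* SL(2, ℂ)) : ℂ :=
  (ρ (proj k n (fa * fb⁻¹))).1.trace

/-- The trace `z = tr ρ(w)`. -/
def trZ {k : ℕ} {n : ℤ} (ρ : KnotGroup k n →* SL(2, ℂ)) : ℂ :=
  (ρ (proj k n (word k))).1.trace

/-- The Chebyshev polynomial of the second kind with `S₀ = 1`, `S₁(v) = v` and
`S_l(v) = v S_{l-1}(v) - S_{l-2}(v)` for all integers `l`, evaluated at `v`. -/
def chebS (l : ℤ) (v : ℂ) : ℂ := (Polynomial.Chebyshev.S ℂ l).eval v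

end DoubleTwist

end

/-!
Let `a` be a meridian and `l` a longitude commuting with it.

A holonomy lift `ρ` is parabolic: if `tr ρ(a)` were not `±2`, then `ρ(a)` and `ρ(l)` would be
simultaneously diagonalizable, and discreteness would force a nontrivial relation
`a ^ i * l ^ j = 1` (a Dirichlet argument in `ℂˣ`). Abelianizing gives `i = 0`, so `l` would be
torsion. But `l` has infinite order: the Riley polynomial has leading coefficient a unit, hence a
root in the ring of algebraic integers, and the parabolic representation over that ring which
belongs to the root sends `l` to `[[-1, 2(2c - 1)], [0, -1]]`, where `2c ≠ 1` because `2` is not a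
unit.

For parabolic `ρ` put `A = Ad ρ(a)`, `B = Ad ρ(b)` and `M = Φ(∂r/∂a)`. The denominator
`det Φ(1 - b)` is `(1 - t)³`. Since `B` is unipotent, Fox's fundamental formula shows that
`(1 - t)³` divides `det M` times every entry of `(tA - 1)(t - 1)³(tB - 1)⁻¹`; at `t = 1` this matrix
becomes `(A - 1)(B - 1)²`, which is nonzero as `ρ` is nonabelian, so `(1 - t)³` divides `det M`.

The extreme coefficients of `det M` are determinants of the leading matrices of `M` at `t = 0` and
`t = ∞`, which are computed by `det (∑_{j < m} Ad(V) ^ j) = m S_{m-1}(tr V)²`. They do not vanish: a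
zero of `S_{m-1}` at the trace of `V` makes `V ^ m` scalar, which either contradicts that `ρ` is
nonabelian or, for odd `k`, the location of the roots of Chebyshev polynomials.
-/

open scoped LaurentPolynomial MatrixGroups Matrix

noncomputable section

namespace DoubleTwist

section Fox

open MonoidAlgebra (of)

variable {α : Type} [DecidableEq α] (j : α)

theorem fox_one : fox j (1 : FreeGroup α) = 0 := by
  simp [fox, foxWord]

theorem fox_inv (g : FreeGroup α) : fox j g⁻¹ = -(of ℤ _ g⁻¹ * fox j g) := by
  have h := fox_mul j g⁻¹ g
  rw [inv_mul_cancel, fox_one] at h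
  exact (neg_eq_of_add_eq_zero_left h.symm).symm

theorem fox_pow (g : FreeGroup α) (n : ℕ) :
    fox j (g ^ n) = (∑ i ∈ Finset.range n, of ℤ _ g ^ i) * fox j g := by
  induction n with
  | zero => simp [fox_one]
  | succ n ih => rw [pow_succ, fox_mul, ih, Finset.sum_range_succ, add_mul, map_pow]

theorem fox_conj_mul_inv {g x y : FreeGroup α} (hx : fox j x = 1) (hy : fox j y = 0) :
    fox j (g * x * g⁻¹ * y⁻¹) = of ℤ _ g + (1 - of ℤ _ (g * x * g⁻¹)) * fox j g := by
  simp only [fox_mul, fox_inv, hx, hy, map_mul, mul_add, mul_one, mul_zero, neg_zero, add_zero,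
    mul_neg, sub_mul, one_mul, mul_assoc]
  abel

theorem sum_fox_mul_of_sub_one [Fintype α] (g : FreeGroup α) :
    ∑ i, fox i g * (of ℤ _ (FreeGroup.of i) - 1) = of ℤ _ g - 1 := by
  have hof (l : α) : ∑ i, fox i (FreeGroup.of l) * (of ℤ _ (FreeGroup.of i) - 1) =
      of ℤ _ (FreeGroup.of l) - 1 := by
    simp only [fox_of, ite_mul, one_mul, zero_mul, Finset.sum_ite_eq, Finset.mem_univ, if_true]
  induction g using FreeGroup.induction_on with
  | C1 => simp only [fox_one, zero_mul, Finset.sum_const_zero, map_one, sub_self]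
  | of l => exact hof l
  | inv_of l _ =>
    simp only [fox_inv, neg_mul, mul_assoc, Finset.sum_neg_distrib, ← Finset.mul_sum, hof]
    rw [mul_sub, ← map_mul, inv_mul_cancel, map_one, mul_one, neg_sub]
  | mul x y hx hy =>
    simp only [fox_mul, add_mul, mul_assoc, Finset.sum_add_distrib, ← Finset.mul_sum, hx, hy]
    rw [map_mul, mul_sub, mul_one]
    abel

end Fox

/-! ### Extreme terms of Laurent polynomials and of matrices of Laurent polynomials -/

section ExtremeTerms

open LaurentPolynomial

variable {R : Type*} [CommRing R]

/-- The term of degree `d` of `f` is `c t^d`, and all terms of higher degree vanish (`c` is allowed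
to be zero). -/
def HasHighestTerm (f : R[T;T⁻¹]) (d : ℤ) (c : R) : Prop :=
  f.coeff d = c ∧ ∀ i, d < i → f.coeff i = 0

/-- The term of degree `e` of `f` is `c t^e`, and all terms of lower degree vanish (`c` is allowed
to be zero). -/
def HasLowestTerm (f : R[T;T⁻¹]) (e : ℤ) (c : R) : Prop :=
  f.coeff e = c ∧ ∀ i, i < e → f.coeff i = 0

theorem coeff_one_sub_T_mul (g : R[T;T⁻¹]) (i : ℤ) :
    ((1 - T 1) * g).coeff i = g.coeff i - g.coeff (i - 1) := by
  rw [sub_mul, one_mul, AddMonoidAlgebra.coeff_sub, Finsupp.sub_apply, T,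
    AddMonoidAlgebra.coeff_single_mul_eq_mul_coeff (m₂ := i - 1) (fun _ _ => by omega), one_mul]

theorem coeff_eq_zero_of_forall_shift {g : R[T;T⁻¹]} {i s : ℤ} (hs : s ≠ 0)
    (h : ∀ n : ℕ, g.coeff (i + n * s) = g.coeff i) : g.coeff i = 0 := by
  by_contra hi
  refine Set.infinite_of_injective_forall_mem (f := fun n : ℕ => i + n * s)
    (fun n n' hn => by simpa [hs] using hn) (fun n => ?_) g.coeff.support.finite_toSet
  rw [Finset.mem_coe, Finsupp.mem_support_iff, h]
  exact hi

theorem HasHighestTerm.of_one_sub_T_mul {g : R[T;T⁻¹]} {d : ℤ} {c : R}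
    (h : HasHighestTerm ((1 - T 1) * g) d c) : HasHighestTerm g (d - 1) (-c) := by
  have hstep (i : ℤ) (hi : d < i) : g.coeff i = g.coeff (i - 1) := by
    rw [← sub_eq_zero, ← coeff_one_sub_T_mul, h.2 i hi]
  have hzero (i : ℤ) (hi : d ≤ i) : g.coeff i = 0 := by
    refine coeff_eq_zero_of_forall_shift one_ne_zero fun n => ?_
    induction n with
    | zero => simp
    | succ n ih => rw [hstep _ (by push_cast; omega), ← ih]; congr 1; push_cast; ring
  refine ⟨?_, fun i hi => hzero i (by omega)⟩
  rw [← h.1, coeff_one_sub_T_mul, hzero d le_rfl, zero_sub, neg_neg]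

theorem HasLowestTerm.of_one_sub_T_mul {g : R[T;T⁻¹]} {e : ℤ} {c : R}
    (h : HasLowestTerm ((1 - T 1) * g) e c) : HasLowestTerm g e c := by
  have hstep (i : ℤ) (hi : i < e) : g.coeff (i - 1) = g.coeff i := by
    rw [eq_comm, ← sub_eq_zero, ← coeff_one_sub_T_mul, h.2 i hi]
  have hzero (i : ℤ) (hi : i < e) : g.coeff i = 0 := by
    refine coeff_eq_zero_of_forall_shift (s := -1) (by norm_num) fun n => ?_
    induction n with
    | zero => simp
    | succ n ih => rw [← ih, ← hstep (i + n * -1) (by omega)]; congr 1; push_cast; ring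
  refine ⟨?_, hzero⟩
  rw [← h.1, coeff_one_sub_T_mul, hzero (e - 1) (by omega), sub_zero]

theorem HasHighestTerm.of_one_sub_T_pow_mul {g : R[T;T⁻¹]} {d : ℤ} {c : R} (n : ℕ)
    (h : HasHighestTerm ((1 - T 1) ^ n * g) d c) : HasHighestTerm g (d - n) ((-1) ^ n * c) := by
  induction n generalizing d c with
  | zero => simpa using h
  | succ n ih =>
    rw [pow_succ', mul_assoc] at h
    convert ih h.of_one_sub_T_mul using 1
    · push_cast; ring
    · ring

theorem HasLowestTerm.of_one_sub_T_pow_mul {g : R[T;T⁻¹]} {e : ℤ} {c : R} (n : ℕ)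
    (h : HasLowestTerm ((1 - T 1) ^ n * g) e c) : HasLowestTerm g e c := by
  induction n with
  | zero => simpa using h
  | succ n ih =>
    rw [pow_succ', mul_assoc] at h
    exact ih h.of_one_sub_T_mul

/-- The substitution `x ↦ t^σ`. For `σ = 1` its image consists of the Laurent polynomials without
pole at `t = 0`, for `σ = -1` of those without pole at `t = ∞`. -/
def substT (σ : ℤ) : Polynomial R →+* R[T;T⁻¹] :=
  Polynomial.eval₂RingHom C (T σ)

theorem substT_X_pow (σ : ℤ) (n : ℕ) : substT σ (Polynomial.X ^ n : Polynomial R) = T (n * σ) := by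
  simp [substT, T_pow]

theorem coeff_T_mul_substT {σ : ℤ} (hσ : σ ≠ 0) (p : Polynomial R) {d i : ℤ}
    (hi : 0 ≤ σ * (d - i)) :
    (T d * substT σ p).coeff i = if i = d then p.coeff 0 else 0 := by
  induction p using Polynomial.induction_on' with
  | add p q hp hq =>
    rw [map_add, mul_add, AddMonoidAlgebra.coeff_add, Finsupp.add_apply, hp, hq,
      Polynomial.coeff_add]
    split_ifs <;> simp
  | monomial n a =>
    have h : T d * substT σ (Polynomial.monomial n a) = (.single (d + n * σ) a : R[T;T⁻¹]) := by
      rw [← Polynomial.C_mul_X_pow_eq_monomial, map_mul, substT_X_pow, single_eq_C_mul_T, T_add]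
      simp only [substT, Polynomial.coe_eval₂RingHom, Polynomial.eval₂_C]
      ring
    rw [h, AddMonoidAlgebra.coeff_single, Finsupp.single_apply, Polynomial.coeff_monomial]
    rcases n.eq_zero_or_pos with rfl | hn
    · simp [eq_comm]
    · have : d + n * σ ≠ i := by
        rintro rfl
        have : 0 < (n : ℤ) * σ ^ 2 := by positivity
        nlinarith
      rw [if_neg this, if_neg hn.ne', ite_self]

variable {ι : Type*} [Fintype ι] [DecidableEq ι]

/-- `N = t^d (L + O(t^σ))`: the expansion at `t = 0` of `N` starts with `t^d L` if `σ = 1`, and its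
expansion at `t = ∞` does if `σ = -1` (`L` is allowed to be zero). -/
def HasLeadingTerm (σ : ℤ) (N : Matrix ι ι R[T;T⁻¹]) (d : ℤ) (L : Matrix ι ι R) : Prop :=
  ∃ P : Matrix ι ι (Polynomial R), N = (T d : R[T;T⁻¹]) • (substT σ).mapMatrix P ∧
    Polynomial.constantCoeff.mapMatrix P = L

namespace HasLeadingTerm

variable {σ : ℤ} {N N' : Matrix ι ι R[T;T⁻¹]} {d d' : ℤ} {L L' : Matrix ι ι R}

theorem add (h : HasLeadingTerm σ N d L) (h' : HasLeadingTerm σ N' d L') :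
    HasLeadingTerm σ (N + N') d (L + L') := by
  obtain ⟨P, rfl, rfl⟩ := h
  obtain ⟨P', rfl, rfl⟩ := h'
  exact ⟨P + P', by rw [map_add, smul_add], map_add _ _ _⟩

theorem neg (h : HasLeadingTerm σ N d L) : HasLeadingTerm σ (-N) d (-L) := by
  obtain ⟨P, rfl, rfl⟩ := h
  exact ⟨-P, by rw [map_neg, smul_neg], map_neg _ _⟩

theorem mul (h : HasLeadingTerm σ N d L) (h' : HasLeadingTerm σ N' d' L') :
    HasLeadingTerm σ (N * N') (d + d') (L * L') := by
  obtain ⟨P, rfl, rfl⟩ := h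
  obtain ⟨P', rfl, rfl⟩ := h'
  exact ⟨P * P', by rw [map_mul, T_add, Matrix.smul_mul, Matrix.mul_smul, smul_smul], map_mul _ _ _⟩

theorem const (L : Matrix ι ι R) : HasLeadingTerm σ (C.mapMatrix L) 0 L := by
  refine ⟨Polynomial.C.mapMatrix L, ?_, ?_⟩ <;> ext1 i j
  · simp [substT]
  · simp

theorem one : HasLeadingTerm σ (1 : Matrix ι ι R[T;T⁻¹]) 0 1 := by
  simpa only [map_one] using const (σ := σ) (1 : Matrix ι ι R)

theorem T_smul (e : ℤ) (h : HasLeadingTerm σ N d L) :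
    HasLeadingTerm σ ((T e : R[T;T⁻¹]) • N) (e + d) L := by
  obtain ⟨P, rfl, rfl⟩ := h
  exact ⟨P, by rw [smul_smul, T_add], rfl⟩

theorem weaken (h : HasLeadingTerm σ N d L) {n : ℕ} (hn : n ≠ 0) (hd : d = d' + n * σ) :
    HasLeadingTerm σ N d' 0 := by
  obtain ⟨P, rfl, rfl⟩ := h
  refine ⟨(Polynomial.X ^ n : Polynomial R) • P, ?_, ?_⟩ <;> ext1 i j
  · simp only [Matrix.smul_apply, RingHom.mapMatrix_apply, Matrix.map_apply, smul_eq_mul, map_mul,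
      substT_X_pow, hd, T_add, mul_assoc]
  · simp [hn.symm]

theorem pow (h : HasLeadingTerm σ N d L) (n : ℕ) : HasLeadingTerm σ (N ^ n) (n * d) (L ^ n) := by
  induction n with
  | zero => simpa using one
  | succ n ih => simpa only [pow_succ, Nat.cast_succ, add_one_mul] using ih.mul h

theorem geom_sum_zero (h : HasLeadingTerm σ N 0 L) (n : ℕ) :
    HasLeadingTerm σ (∑ i ∈ Finset.range n, N ^ i) 0 (∑ i ∈ Finset.range n, L ^ i) := by
  induction n with
  | zero => simpa using const (σ := σ) (0 : Matrix ι ι R)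
  | succ n ih =>
    rw [Finset.sum_range_succ, Finset.sum_range_succ]
    simpa only [mul_zero] using ih.add (by simpa only [mul_zero] using h.pow n)

theorem geom_sum_const {k : ℕ} (hk : k ≠ 0) (h : HasLeadingTerm σ N (k * σ) L) (n : ℕ) :
    HasLeadingTerm σ (∑ i ∈ Finset.range (n + 1), N ^ i) 0 1 := by
  induction n with
  | zero => simpa using one
  | succ n ih =>
    rw [Finset.sum_range_succ]
    have hpow := (h.pow (n + 1)).weaken (d' := 0) (n := (n + 1) * k) (by positivity)
      (by push_cast; ring)
    simpa only [add_zero] using ih.add hpow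

theorem geom_sum {k : ℕ} (hk : k ≠ 0) (h : HasLeadingTerm σ N (-(k * σ)) L) (n : ℕ) :
    HasLeadingTerm σ (∑ i ∈ Finset.range (n + 1), N ^ i) (n * -(k * σ)) (L ^ n) := by
  induction n with
  | zero => simpa using one
  | succ n ih =>
    rw [Finset.sum_range_succ]
    simpa only [zero_add] using (ih.weaken hk (by push_cast; ring)).add (h.pow (n + 1))

theorem coeff_det (hσ : σ ≠ 0) (h : HasLeadingTerm σ N d L) {i : ℤ}
    (hi : 0 ≤ σ * (Fintype.card ι * d - i)) :
    N.det.coeff i = if i = Fintype.card ι * d then L.det else 0 := by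
  obtain ⟨P, rfl, rfl⟩ := h
  rw [Matrix.det_smul, T_pow, ← RingHom.map_det, coeff_T_mul_substT hσ _ hi, ← RingHom.map_det,
    Polynomial.constantCoeff_apply]

theorem hasLowestTerm_det (h : HasLeadingTerm 1 N d L) :
    HasLowestTerm N.det (Fintype.card ι * d) L.det :=
  ⟨by rw [h.coeff_det one_ne_zero (by simp), if_pos rfl],
    fun i hi => by rw [h.coeff_det one_ne_zero (by omega), if_neg hi.ne]⟩

theorem hasHighestTerm_det (h : HasLeadingTerm (-1) N d L) :
    HasHighestTerm N.det (Fintype.card ι * d) L.det :=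
  ⟨by rw [h.coeff_det (by norm_num) (by simp), if_pos rfl],
    fun i hi => by rw [h.coeff_det (by norm_num) (by omega), if_neg hi.ne']⟩

end HasLeadingTerm

end ExtremeTerms

/-! ### Powers in `SL₂` and Chebyshev polynomials -/

section Chebyshev

open Polynomial (Chebyshev.S)

variable {R : Type*} [CommRing R]

theorem eval_chebyshev_S_add_one (l : ℤ) (v : R) :
    (Chebyshev.S R (l + 1)).eval v =
      v * (Chebyshev.S R l).eval v - (Chebyshev.S R (l - 1)).eval v := by
  rw [Polynomial.Chebyshev.S_add_one, Polynomial.eval_sub, Polynomial.eval_mul, Polynomial.eval_X]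

theorem sum_pow_sq_mul {x y : R} (hxy : x * y = 1) (m : ℕ) :
    (∑ j ∈ Finset.range m, (x ^ j) ^ 2) * x =
      x ^ m * (Chebyshev.S R ((m : ℤ) - 1)).eval (x + y) := by
  induction m using Nat.twoStepInduction with
  | zero => simp
  | one => simp
  | more m ih ih' =>
    have hrec := eval_chebyshev_S_add_one (m : ℤ) (x + y)
    push_cast at ih' ⊢
    rw [add_sub_cancel_right] at ih'
    rw [show (m : ℤ) + 2 - 1 = m + 1 by ring, hrec]
    rw [Finset.sum_range_succ] at ih' ⊢
    rw [Finset.sum_range_succ]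
    linear_combination (1 + x ^ 2) * ih' - x ^ 2 * ih -
      x ^ (m + 1) * (Chebyshev.S R m).eval (x + y) * hxy

theorem trace_smul_one_sub_eq (V : Matrix (Fin 2) (Fin 2) R) : V.trace • 1 - V = V.adjugate := by
  rw [Matrix.adjugate_fin_two, Matrix.trace_fin_two]
  ext i j
  fin_cases i <;> fin_cases j <;> simp

theorem mul_self_of_det_eq_one {V : Matrix (Fin 2) (Fin 2) R} (hV : V.det = 1) :
    V * V = V.trace • V - 1 := by
  have h := V.mul_adjugate
  rw [← trace_smul_one_sub_eq, hV, one_smul, mul_sub, Matrix.mul_smul, mul_one] at h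
  rw [← h, sub_sub_cancel]

theorem pow_eq_chebyshev {V : Matrix (Fin 2) (Fin 2) R} (hV : V.det = 1) (n : ℕ) :
    V ^ n = (Chebyshev.S R ((n : ℤ) - 1)).eval V.trace • V -
      (Chebyshev.S R ((n : ℤ) - 2)).eval V.trace • 1 := by
  induction n with
  | zero => simp
  | succ n ih =>
    have hrec := eval_chebyshev_S_add_one ((n : ℤ) - 1) V.trace
    rw [sub_add_cancel, sub_sub, one_add_one_eq_two] at hrec
    rw [pow_succ, ih, sub_mul, Matrix.smul_mul, mul_self_of_det_eq_one hV, Matrix.smul_mul,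
      one_mul]
    push_cast
    rw [add_sub_cancel_right, hrec, show (n : ℤ) + 1 - 2 = n - 1 by ring]
    module

theorem trace_conj {m : Type*} [Fintype m] [DecidableEq m] (P V : Matrix.SpecialLinearGroup m R) :
    (P * V * P⁻¹).1.trace = V.1.trace := by
  rw [Matrix.SpecialLinearGroup.coe_mul, Matrix.trace_mul_comm, ← Matrix.SpecialLinearGroup.coe_mul,
    inv_mul_cancel_left]

theorem trace_inv (V : SL(2, R)) : (V⁻¹).1.trace = V.1.trace := by
  rw [Matrix.SpecialLinearGroup.coe_inv, ← trace_smul_one_sub_eq, Matrix.trace_sub,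
    Matrix.trace_smul, Matrix.trace_one, Fintype.card_fin, smul_eq_mul]
  push_cast
  ring

theorem coe_inv_eq_trace_smul_one_sub (V : SL(2, R)) : (V⁻¹).1 = V.1.trace • 1 - V.1 := by
  rw [Matrix.SpecialLinearGroup.coe_inv, trace_smul_one_sub_eq]

theorem apply_mul_apply_sub (V : SL(2, R)) : V 0 0 * V 1 1 - V 0 1 * V 1 0 = 1 := by
  rw [← Matrix.det_fin_two]
  exact V.2

theorem commute_of_eq_smul_one {V : SL(2, R)} {s : R} (h : V.1 = s • 1) (X : SL(2, R)) :
    Commute V X := by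
  apply Subtype.ext
  rw [Matrix.SpecialLinearGroup.coe_mul, Matrix.SpecialLinearGroup.coe_mul, h, Matrix.smul_mul,
    Matrix.mul_smul, one_mul, mul_one]

theorem exists_add_of_mul_eq_one {K : Type*} [Field K] [IsAlgClosed K] (v : K) :
    ∃ x y : K, x * y = 1 ∧ x + y = v := by
  obtain ⟨x, hx⟩ := IsAlgClosed.exists_root
    (Polynomial.X ^ 2 - Polynomial.C v * Polynomial.X + 1 : Polynomial K) (by
      rw [show (Polynomial.X ^ 2 - Polynomial.C v * Polynomial.X + 1 : Polynomial K) =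
        Polynomial.C 1 * Polynomial.X ^ 2 + Polynomial.C (-v) * Polynomial.X + Polynomial.C 1 by
          simp only [Polynomial.C_1, Polynomial.C_neg]; ring,
        Polynomial.degree_quadratic one_ne_zero]
      norm_num)
  simp only [Polynomial.IsRoot, Polynomial.eval_add, Polynomial.eval_sub, Polynomial.eval_pow,
    Polynomial.eval_X, Polynomial.eval_mul, Polynomial.eval_C, Polynomial.eval_one] at hx
  exact ⟨x, v - x, by linear_combination -hx, by ring⟩

theorem exists_eq_conj_triangular {K : Type*} [Field K] [IsAlgClosed K] (V : SL(2, K)) :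
    ∃ P U : SL(2, K), V = P * U * P⁻¹ ∧ U 1 0 = 0 := by
  suffices h : ∃ P : SL(2, K), (P⁻¹ * V * P) 1 0 = 0 by
    obtain ⟨P, hP⟩ := h
    exact ⟨P, P⁻¹ * V * P, by group, hP⟩
  by_cases hr : V 1 0 = 0
  · exact ⟨1, by simpa using hr⟩
  obtain ⟨x, y, hxy, htr⟩ := exists_add_of_mul_eq_one (V 0 0 + V 1 1)
  -- The first column of `P` is an eigenvector of `V` for the eigenvalue `x`.
  let P : SL(2, K) := ⟨!![x - V 1 1, -(V 1 0)⁻¹; V 1 0, 0], by simp [Matrix.det_fin_two, hr]⟩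
  have hinv : (P⁻¹).1 = !![0, (V 1 0)⁻¹; -(V 1 0), x - V 1 1] := by
    rw [Matrix.SpecialLinearGroup.coe_inv, Matrix.adjugate_fin_two_of, neg_neg]
  refine ⟨P, ?_⟩
  rw [Matrix.SpecialLinearGroup.coe_mul, Matrix.SpecialLinearGroup.coe_mul, hinv]
  simp only [P, Matrix.mul_apply, Fin.sum_univ_two, Matrix.of_apply, Matrix.cons_val]
  linear_combination V 1 0 * (apply_mul_apply_sub V + x * htr - hxy)

end Chebyshev

/-! ### Location of the roots of some Chebyshev polynomials -/

section Roots

theorem re_add_of_norm_eq_one {x y : ℂ} (hx : ‖x‖ = 1) (hxy : x * y = 1) :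
    (x + y).re = 2 * x.re := by
  rw [eq_inv_of_mul_eq_one_right hxy, Complex.inv_eq_conj hx]
  simp [two_mul]

theorem eq_one_of_norm_eq_one_of_one_le_re {x : ℂ} (hx : ‖x‖ = 1) (hre : 1 ≤ x.re) : x = 1 := by
  have hre_eq : x.re = 1 := le_antisymm ((Complex.re_le_norm x).trans hx.le) hre
  have him : x.im = 0 := Complex.abs_re_eq_norm.1 (by rw [hre_eq, hx, abs_one])
  exact Complex.ext hre_eq him

theorem re_lt_two_of_chebS_eq_zero {m : ℕ} (hm : m ≠ 0) {v : ℂ} (h : chebS (m - 1) v = 0) :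
    v.re < 2 := by
  obtain ⟨x, y, hxy, rfl⟩ := exists_add_of_mul_eq_one v
  have hsum : ∑ j ∈ Finset.range m, (x ^ 2) ^ j = 0 := by
    have := sum_pow_sq_mul hxy m
    rw [← chebS, h, mul_zero] at this
    simpa only [pow_right_comm, left_ne_zero_of_mul_eq_one hxy, mul_eq_zero, or_false] using this
  have hroot : x ^ (2 * m) = 1 := by
    rw [pow_mul, ← sub_eq_zero, ← geom_sum_mul, hsum, zero_mul]
  have hx : ‖x‖ = 1 := Complex.norm_eq_one_of_pow_eq_one hroot (by omega)
  rw [re_add_of_norm_eq_one hx hxy]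
  by_contra! hre
  obtain rfl := eq_one_of_norm_eq_one_of_one_le_re hx (by linarith)
  simp [hm] at hsum

theorem re_le_two_of_chebS_eq {n : ℕ} {v : ℂ} (h : chebS n v = chebS (n - 1) v) : v.re ≤ 2 := by
  obtain ⟨x, y, hxy, rfl⟩ := exists_add_of_mul_eq_one v
  have hsum : ∑ j ∈ Finset.range (n + 1), (x ^ 2) ^ j = x * ∑ j ∈ Finset.range n, (x ^ 2) ^ j := by
    have hn := sum_pow_sq_mul hxy n
    have hn' := sum_pow_sq_mul hxy (n + 1)
    rw [Nat.cast_add, Nat.cast_one, add_sub_cancel_right, ← chebS, h, pow_succ', mul_assoc, chebS,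
      ← hn] at hn'
    simp only [← pow_mul, mul_comm] at hn' ⊢
    exact mul_left_cancel₀ (left_ne_zero_of_mul_eq_one hxy) hn'
  have hroot : (x ^ (2 * n + 1) + 1) * (x - 1) = 0 := by
    have hn := geom_sum_mul (x ^ 2) n
    have hn' := geom_sum_mul (x ^ 2) (n + 1)
    rw [hsum, mul_assoc, hn] at hn'
    simp only [← pow_mul] at hn'
    linear_combination -hn'
  have hx : ‖x‖ = 1 := by
    rcases mul_eq_zero.1 hroot with hx | hx
    · refine Complex.norm_eq_one_of_pow_eq_one (n := (2 * n + 1) * 2) ?_ (by omega)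
      rw [pow_mul, eq_neg_of_add_eq_zero_left hx, neg_one_sq]
    · rw [sub_eq_zero.1 hx, norm_one]
  rw [re_add_of_norm_eq_one hx hxy]
  linarith [(Complex.re_le_norm x).trans hx.le]

end Roots

/-! ### The adjoint representation -/

section Adjoint

theorem Ad_apply (V : SL(2, ℂ)) : Ad V =
    !![V 0 0 ^ 2, -2 * V 0 0 * V 0 1, -V 0 1 ^ 2;
      -V 0 0 * V 1 0, V 0 0 * V 1 1 + V 0 1 * V 1 0, V 0 1 * V 1 1;
      -V 1 0 ^ 2, 2 * V 1 0 * V 1 1, V 1 1 ^ 2] := by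
  have hcol (j : Fin 3) : (adjointAction V (sl2Equiv.symm (Pi.single j 1))).1 =
      V.1 * !![(Pi.single j 1 : Fin 3 → ℂ) 1, (Pi.single j 1 : Fin 3 → ℂ) 0;
        (Pi.single j 1 : Fin 3 → ℂ) 2, -(Pi.single j 1 : Fin 3 → ℂ) 1] *
        !![V 1 1, -V 0 1; -V 1 0, V 0 0] := by
    rw [← Matrix.adjugate_fin_two]
    rfl
  ext i j
  have hentry : Ad V i j = sl2Equiv (adjointAction V (sl2Equiv.symm (Pi.single j 1))) i := by
    change LinearMap.toMatrix sl2Basis sl2Basis (adjointAction V) i j = _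
    rw [LinearMap.toMatrix_apply]
    simp [sl2Basis]
  rw [hentry]
  change (![_, _, _] : Fin 3 → ℂ) i = _
  rw [hcol, Matrix.eta_fin_two V.1]
  fin_cases j <;> fin_cases i <;> simp [Matrix.mul_apply, Fin.sum_univ_two] <;> ring

theorem det_Ad (V : SL(2, ℂ)) : (Ad V).det = 1 := by
  have h : (Ad V).det = (V 0 0 * V 1 1 - V 0 1 * V 1 0) ^ 3 := by
    rw [Ad_apply, Matrix.det_fin_three]
    simp only [Matrix.of_apply, Matrix.cons_val]
    ring
  rw [h, apply_mul_apply_sub, one_pow]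

theorem det_one_sub_smul_Ad {R : Type*} [CommRing R] (f : ℂ →+* R) (x : R) (V : SL(2, ℂ)) :
    (1 - x • f.mapMatrix (Ad V)).det =
      (1 - x) * (1 - (f V.1.trace ^ 2 - 2) * x + x ^ 2) := by
  have hdet : f (V 0 0) * f (V 1 1) - f (V 0 1) * f (V 1 0) = 1 := by
    rw [← map_mul, ← map_mul, ← map_sub, apply_mul_apply_sub, map_one]
  generalize hD : f (V 0 0) * f (V 1 1) - f (V 0 1) * f (V 1 0) = D at hdet
  have h : (1 - x • f.mapMatrix (Ad V)).det =
      (1 - D * x) * (1 - (f V.1.trace ^ 2 - 2 * D) * x + D ^ 2 * x ^ 2) := by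
    rw [Ad_apply, Matrix.det_fin_three, Matrix.trace_fin_two, ← hD]
    simp [map_ofNat f 2]
    ring
  rw [h, hdet]
  ring

theorem det_sum_Ad_pow_of_triangular {U : SL(2, ℂ)} (hU : U 1 0 = 0) (m : ℕ) :
    (∑ j ∈ Finset.range m, Ad U ^ j).det = m * chebS (m - 1) U.1.trace ^ 2 := by
  have hdet : U 0 0 * U 1 1 = 1 := by
    simpa only [hU, mul_zero, sub_zero] using apply_mul_apply_sub U
  have hpow (j : ℕ) : (U ^ j) 1 0 = 0 ∧ (U ^ j) 0 0 = U 0 0 ^ j ∧ (U ^ j) 1 1 = U 1 1 ^ j := by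
    induction j with
    | zero => simp
    | succ j ih =>
      rw [pow_succ, Matrix.SpecialLinearGroup.coe_mul]
      simp only [Matrix.mul_apply, Fin.sum_univ_two, ih, hU, pow_succ]
      simp
  have hprod : (∑ j ∈ Finset.range m, Ad U ^ j).det = m *
      ((∑ j ∈ Finset.range m, (U 0 0 ^ j) ^ 2) * ∑ j ∈ Finset.range m, (U 1 1 ^ j) ^ 2) := by
    simp_rw [← map_pow Ad]
    simp only [Matrix.det_fin_three, Matrix.sum_apply, Ad_apply, hpow, Matrix.of_apply,
      Matrix.cons_val, mul_zero, zero_mul, add_zero, neg_zero, Finset.sum_const_zero, sub_zero,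
      ← mul_pow, hdet, one_pow, Finset.sum_const, Finset.card_range, nsmul_eq_mul, mul_one,
      zero_pow two_ne_zero]
    ring
  have hfst := sum_pow_sq_mul hdet m
  have hsnd := sum_pow_sq_mul ((mul_comm _ _).trans hdet) m
  rw [add_comm] at hsnd
  have hmul := congrArg₂ (· * ·) hfst hsnd
  rw [mul_mul_mul_comm, hdet, mul_one, mul_mul_mul_comm, ← mul_pow, hdet, one_pow, one_mul] at hmul
  rw [hprod, hmul, sq, Matrix.trace_fin_two, chebS]

theorem det_sum_Ad_pow (V : SL(2, ℂ)) (m : ℕ) :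
    (∑ j ∈ Finset.range m, Ad V ^ j).det = m * chebS (m - 1) V.1.trace ^ 2 := by
  obtain ⟨P, U, rfl, hU⟩ := exists_eq_conj_triangular V
  have hconj : ∑ j ∈ Finset.range m, Ad (P * U * P⁻¹) ^ j =
      Ad P * (∑ j ∈ Finset.range m, Ad U ^ j) * Ad P⁻¹ := by
    rw [Finset.mul_sum, Finset.sum_mul]
    refine Finset.sum_congr rfl fun j _ => ?_
    rw [← map_pow, conj_pow, map_mul, map_mul, map_pow]
  rw [hconj, Matrix.det_mul, Matrix.det_mul, det_Ad, det_Ad, one_mul, mul_one,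
    det_sum_Ad_pow_of_triangular hU, trace_conj]

end Adjoint

section Unipotent

variable {V : SL(2, ℂ)} {ε : ℂ} {N : Matrix (Fin 2) (Fin 2) ℂ}

theorem exists_eq_smul_one_add (hV : V.1.trace ^ 2 = 4) :
    ∃ (ε : ℂ) (N : Matrix (Fin 2) (Fin 2) ℂ), ε * ε = 1 ∧ N * N = 0 ∧ N.trace = 0 ∧
      V.1 = ε • (1 + N) ∧ (V⁻¹).1 = ε • (1 - N) := by
  obtain ⟨ε, htr⟩ : ∃ ε, V.1.trace = 2 * ε := ⟨V.1.trace / 2, by ring⟩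
  have hε : ε * ε = 1 := by linear_combination (hV - (V.1.trace + 2 * ε) * htr) / 4
  refine ⟨ε, ε • V.1 - 1, hε, ?_, ?_, ?_, ?_⟩
  · rw [sub_mul, mul_sub, Matrix.smul_mul, Matrix.mul_smul, mul_self_of_det_eq_one V.2, htr,
      one_mul, mul_one, smul_sub, smul_sub, smul_smul, smul_smul, smul_smul, ← mul_assoc,
      hε]
    module
  · rw [Matrix.trace_sub, Matrix.trace_smul, htr, Matrix.trace_one, Fintype.card_fin, smul_eq_mul]
    push_cast
    linear_combination 2 * hε
  · rw [add_sub_cancel, smul_smul, hε, one_smul]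
  · rw [coe_inv_eq_trace_smul_one_sub, htr, smul_sub, smul_sub, smul_smul, hε]
    module

theorem adjointAction_sub_one_apply (hε : ε * ε = 1) (hV : V.1 = ε • (1 + N))
    (hV' : (V⁻¹).1 = ε • (1 - N)) (X : sl2) :
    ((adjointAction V - 1) X).1 = N * X.1 - X.1 * N - N * X.1 * N := by
  change V.1 * X.1 * (V⁻¹).1 - X.1 = _
  rw [hV, hV', Matrix.smul_mul, Matrix.smul_mul, Matrix.mul_smul, smul_smul, hε, one_smul]
  noncomm_ring

theorem adjointAction_sub_one_sq_apply (hε : ε * ε = 1) (hN : N * N = 0) (hV : V.1 = ε • (1 + N))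
    (hV' : (V⁻¹).1 = ε • (1 - N)) (X : sl2) :
    (((adjointAction V - 1) ^ 2 : Module.End ℂ sl2) X).1 = -2 • (N * X.1 * N) := by
  have hN' (Y : Matrix (Fin 2) (Fin 2) ℂ) : N * (N * Y) = 0 := by rw [← mul_assoc, hN, zero_mul]
  rw [sq, Module.End.mul_apply, adjointAction_sub_one_apply hε hV hV',
    adjointAction_sub_one_apply hε hV hV']
  simp only [mul_sub, sub_mul, mul_assoc, hN, hN', mul_zero]
  module

theorem Ad_sub_one_pow_three (hV : V.1.trace ^ 2 = 4) : (Ad V - 1) ^ 3 = 0 := by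
  obtain ⟨ε, N, hε, hN, -, hV, hV'⟩ := exists_eq_smul_one_add hV
  have h : (adjointAction V - 1) ^ 3 = 0 := by
    ext1 X
    apply Subtype.ext
    rw [pow_succ', Module.End.mul_apply, adjointAction_sub_one_apply hε hV hV',
      adjointAction_sub_one_sq_apply hε hN hV hV']
    have hN' (Y : Matrix (Fin 2) (Fin 2) ℂ) : N * (N * Y) = 0 := by rw [← mul_assoc, hN, zero_mul]
    simp only [Matrix.smul_mul, Matrix.mul_smul, mul_assoc, hN, hN', mul_zero, smul_zero, zero_mul,
      sub_zero]
    rfl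
  have := congrArg (LinearMap.toMatrixAlgEquiv sl2Basis) h
  rwa [map_pow, map_sub, map_one, map_zero] at this

theorem mul_mul_self_eq_trace_smul {R : Type*} [CommRing R] {N : Matrix (Fin 2) (Fin 2) R}
    (hN : N.det = 0) (Y : Matrix (Fin 2) (Fin 2) R) : N * Y * N = (N * Y).trace • N := by
  rw [Matrix.det_fin_two] at hN
  ext i j
  fin_cases i <;> fin_cases j <;>
    simp [Matrix.mul_apply, Matrix.trace_fin_two]
  · linear_combination (-Y 1 1) * hN
  · linear_combination Y 0 1 * hN
  · linear_combination Y 1 0 * hN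
  · linear_combination (-Y 0 0) * hN

theorem commute_of_adjointAction_eq {A : SL(2, ℂ)} {X : sl2} (h : adjointAction A X = X) :
    Commute A.1 X.1 := by
  have h' : A.1 * X.1 * (A⁻¹).1 = X.1 := congrArg Subtype.val h
  calc A.1 * X.1 = A.1 * X.1 * ((A⁻¹).1 * A.1) := by
        rw [← Matrix.SpecialLinearGroup.coe_mul, inv_mul_cancel, Matrix.SpecialLinearGroup.coe_one,
          mul_one]
    _ = X.1 * A.1 := by rw [← mul_assoc, h']

open scoped ComplexOrder in
/-- The image of `(Ad V - 1) ^ 2` is spanned by the nilpotent part of `V`, so a matrix fixing it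
commutes with `V`. -/
theorem Ad_sub_one_mul_sq_ne_zero {A : SL(2, ℂ)} (hV : V.1.trace ^ 2 = 4) (hAV : ¬Commute A V) :
    (Ad A - 1) * (Ad V - 1) ^ 2 ≠ 0 := by
  intro h
  obtain ⟨ε, N, hε, hN, htr, hV, hV'⟩ := exists_eq_smul_one_add hV
  have hfix (X : sl2) :
      adjointAction A (((adjointAction V - 1) ^ 2 : Module.End ℂ sl2) X) =
        ((adjointAction V - 1) ^ 2 : Module.End ℂ sl2) X := by
    have hEnd : (adjointAction A - 1) * (adjointAction V - 1) ^ 2 = 0 := by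
      apply (LinearMap.toMatrixAlgEquiv sl2Basis).injective
      rw [map_mul, map_pow, map_sub, map_sub, map_one, map_zero]
      exact h
    exact sub_eq_zero.1 (LinearMap.congr_fun hEnd X)
  have hdet : N.det = 0 := by
    rw [← sq_eq_zero_iff, sq, ← Matrix.det_mul, hN, Matrix.det_zero]
  have hN0 : N ≠ 0 := by
    rintro rfl
    exact hAV (commute_of_eq_smul_one (by rw [hV, add_zero]) A).symm
  let X : sl2 := ⟨Nᴴ, mem_sl2 (by rw [Matrix.trace_conjTranspose, htr, star_zero])⟩
  have himage : (((adjointAction V - 1) ^ 2 : Module.End ℂ sl2) X).1 =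
      (-2 * (N * Nᴴ).trace) • N := by
    rw [adjointAction_sub_one_sq_apply hε hN hV hV', mul_mul_self_eq_trace_smul hdet]
    module
  have hc : -2 * (N * Nᴴ).trace ≠ 0 :=
    mul_ne_zero (by norm_num) (Matrix.trace_mul_conjTranspose_self_eq_zero_iff.not.2 hN0)
  have hcomm := commute_of_adjointAction_eq (hfix X)
  rw [himage, Commute.smul_right_iff₀ hc] at hcomm
  refine hAV (Subtype.ext ?_)
  rw [Matrix.SpecialLinearGroup.coe_mul, Matrix.SpecialLinearGroup.coe_mul, hV]
  exact ((Commute.one_right A.1).add_right hcomm).smul_right ε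

end Unipotent

/-! ### The word `w` and its Fox derivative -/

section Word

open MonoidAlgebra (of)

/-- The word `w` of `J(k, 2n)` evaluated at two elements of a group. -/
def wordIn {G : Type*} [Group G] (k : ℕ) (a b : G) : G :=
  (b * a⁻¹) ^ (k / 2) * (if Even k then 1 else b * a) * (b⁻¹ * a) ^ (k / 2)

theorem wordIn_two_mul {G : Type*} [Group G] (m : ℕ) (a b : G) :
    wordIn (2 * m) a b = (b * a⁻¹) ^ m * 1 * (b⁻¹ * a) ^ m := by
  rw [wordIn, if_pos (even_two_mul m), Nat.mul_div_cancel_left m two_pos]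

theorem wordIn_two_mul_add_one {G : Type*} [Group G] (m : ℕ) (a b : G) :
    wordIn (2 * m + 1) a b = (b * a⁻¹) ^ m * (b * a) * (b⁻¹ * a) ^ m := by
  rw [wordIn, if_neg (by simp [parity_simps]), show (2 * m + 1) / 2 = m by omega]

theorem map_wordIn {G H : Type*} [Group G] [Group H] (f : G →* H) (k : ℕ) (a b : G) :
    f (wordIn k a b) = wordIn k (f a) (f b) := by
  simp only [wordIn, map_mul, map_pow, map_inv, apply_ite f, map_one]

theorem word_eq_wordIn (k : ℕ) : word k = wordIn k fa fb := rfl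

theorem fox_fa : fox 0 fa = 1 := fox_of 0 0

theorem fox_fb : fox 0 fb = 0 := fox_of 1 0

theorem fox_conj_mul_conj (g : F2) (m : ℕ) :
    fox 0 ((fb * fa⁻¹) ^ m * g * (fb⁻¹ * fa) ^ m) =
      -((∑ i ∈ Finset.range m, of ℤ _ (fb * fa⁻¹) ^ i) * of ℤ _ (fb * fa⁻¹)) +
        of ℤ _ (fb * fa⁻¹) ^ m * (fox 0 g + of ℤ _ g *
          ((∑ i ∈ Finset.range m, of ℤ _ (fb⁻¹ * fa) ^ i) * of ℤ _ fb⁻¹)) := by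
  have hc : fox 0 (fb * fa⁻¹) = -of ℤ _ (fb * fa⁻¹) := by
    rw [fox_mul, fox_fb, zero_add, fox_inv, fox_fa, mul_one, mul_neg, ← map_mul]
  have hd : fox 0 (fb⁻¹ * fa) = of ℤ _ fb⁻¹ := by
    rw [fox_mul, fox_inv, fox_fb, mul_zero, neg_zero, zero_add, fox_fa, mul_one]
  rw [mul_assoc, fox_mul, fox_mul, fox_pow, fox_pow, hc, hd, mul_neg, map_pow]

end Word

/-! ### The twisted Fox calculus -/

section TwistedFox

open LaurentPolynomial MonoidAlgebra

variable {k : ℕ} {n : ℤ} (ρ : KnotGroup k n →* SL(2, ℂ))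

theorem abel_proj_fa : abel k n (proj k n fa) = Multiplicative.ofAdd 1 :=
  PresentedGroup.toGroup.of _

theorem abel_proj_fb : abel k n (proj k n fb) = Multiplicative.ofAdd 1 :=
  PresentedGroup.toGroup.of _

theorem proj_relator : proj k n (relator k n) = 1 :=
  PresentedGroup.one_of_mem (Set.mem_singleton _)

theorem semiconjBy_proj_word :
    SemiconjBy (proj k n (word k) ^ n) (proj k n fa) (proj k n fb) := by
  have h : proj k n (word k ^ n * fa * word k ^ (-n) * fb⁻¹) = 1 := proj_relator
  rwa [map_mul, map_inv, mul_inv_eq_one, map_mul, map_mul, zpow_neg, map_inv,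
    mul_inv_eq_iff_eq_mul, map_zpow] at h

/-- The adjoint representation `Ad ∘ ρ` on words in the meridians. -/
def AdRep : F2 →* Matrix (Fin 3) (Fin 3) ℂ :=
  Ad.comp (ρ.comp (proj k n))

theorem det_AdRep (g : F2) : (AdRep ρ g).det = 1 := det_Ad _

theorem det_sum_AdRep_pow (g : F2) (m : ℕ) : (∑ i ∈ Finset.range m, AdRep ρ g ^ i).det =
    m * chebS (m - 1) (ρ (proj k n g)).1.trace ^ 2 :=
  det_sum_Ad_pow _ _

theorem Phi_of (g : F2) : Phi ρ (of ℤ _ g) = tensorRep ρ (proj k n g) := by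
  rw [Phi, lift_of, MonoidHom.comp_apply]

theorem Phi_of_eq_T_smul {g : F2} {d : ℤ}
    (hg : abel k n (proj k n g) = Multiplicative.ofAdd d) :
    Phi ρ (of ℤ _ g) = (T d : ℂ[T;T⁻¹]) • (C : ℂ →+* ℂ[T;T⁻¹]).mapMatrix (AdRep ρ g) := by
  rw [Phi_of, ← toAdd_ofAdd d, ← hg]
  rfl

theorem HasLeadingTerm.Phi_of (σ : ℤ) {g : F2} {d : ℤ}
    (hg : abel k n (proj k n g) = Multiplicative.ofAdd d) :
    HasLeadingTerm σ (Phi ρ (of ℤ _ g)) d (AdRep ρ g) := by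
  rw [Phi_of_eq_T_smul ρ hg]
  simpa only [add_zero] using (HasLeadingTerm.const _).T_smul d

theorem Phi_fox_relator (N : ℕ) (ρ : KnotGroup k (N : ℤ) →* SL(2, ℂ)) :
    Phi ρ (fox 0 (relator k N)) = Phi ρ (of ℤ _ (word k)) ^ N +
      (1 - Phi ρ (of ℤ _ fb)) * (∑ i ∈ Finset.range N, Phi ρ (of ℤ _ (word k)) ^ i) *
        Phi ρ (fox 0 (word k)) := by
  have hconj : Phi ρ (of ℤ _ (word k ^ N * fa * (word k ^ N)⁻¹)) = Phi ρ (of ℤ _ fb) := by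
    have h := (semiconjBy_proj_word (k := k) (n := N)).eq
    rw [zpow_natCast] at h
    rw [Phi_of, Phi_of, map_mul (proj k N), map_mul (proj k N), map_inv (proj k N),
      map_pow (proj k N), h, mul_inv_cancel_right]
  rw [relator, zpow_neg, zpow_natCast, fox_conj_mul_inv 0 fox_fa fox_fb, fox_pow, ← mul_assoc]
  simp only [map_add, map_mul (Phi ρ), map_sub, map_one, hconj, map_sum, map_pow]

theorem trace_fb : (ρ (proj k n fb)).1.trace = (ρ (proj k n fa)).1.trace := by
  rw [← trace_conj (ρ (proj k n (word k) ^ n)) (ρ (proj k n fa))]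
  rw [← map_inv, ← map_mul, ← map_mul, semiconjBy_proj_word.eq, mul_inv_cancel_right]

theorem map_mem_of_map_generators_mem {G : Type*} [Group G] (φ : KnotGroup k n →* G)
    {S : Subgroup G} (ha : φ (proj k n fa) ∈ S) (hb : φ (proj k n fb) ∈ S) (g : KnotGroup k n) :
    φ g ∈ S := by
  have hS : S.comap φ = ⊤ := by
    rw [eq_top_iff, ← PresentedGroup.closure_range_of, Subgroup.closure_le, Set.range_subset_iff]
    exact Fin.forall_fin_two.2 ⟨ha, hb⟩
  exact hS.ge (Subgroup.mem_top g)

variable {ρ}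

theorem IsNonabelian.not_commute (h : IsNonabelian ρ) :
    ¬Commute (ρ (proj k n fa)) (ρ (proj k n fb)) := by
  intro hab
  have hgen (X : SL(2, ℂ)) (ha : Commute X (ρ (proj k n fa))) (hb : Commute X (ρ (proj k n fb)))
      (g : KnotGroup k n) : Commute X (ρ g) :=
    (Subgroup.mem_centralizer_singleton_iff.1 (map_mem_of_map_generators_mem ρ
      (Subgroup.mem_centralizer_singleton_iff.2 ha.eq.symm)
      (Subgroup.mem_centralizer_singleton_iff.2 hb.eq.symm) g)).symm
  obtain ⟨g, g', hgg'⟩ := h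
  exact hgg' (hgen _ (hgen _ (.refl _) hab g).symm (hgen _ hab.symm (.refl _) g).symm g')

theorem IsParabolic.trace_fb_sq (h : IsParabolic ρ) : (ρ (proj k n fb)).1.trace ^ 2 = 4 := by
  rw [trace_fb]
  rcases h.2 with h | h <;> rw [h] <;> norm_num

/-- The inverse of `t B - 1` is `(t - 1)⁻³` times this element if `(B - 1)³ = 0`. -/
def unipotentAdjoint {R S : Type*} [CommRing R] [Ring S] [Algebra R S] (t : R) (B : S) : S :=
  (t - 1) ^ 2 • 1 - ((t - 1) * t) • (B - 1) + t ^ 2 • (B - 1) ^ 2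

theorem smul_sub_one_mul_unipotentAdjoint {R S : Type*} [CommRing R] [Ring S] [Algebra R S]
    (t : R) {B : S} (hB : (B - 1) ^ 3 = 0) :
    (t • B - 1) * unipotentAdjoint t B = (t - 1) ^ 3 • 1 := by
  obtain ⟨Z, rfl⟩ : ∃ Z, B = 1 + Z := ⟨B - 1, by abel⟩
  rw [add_sub_cancel_left] at hB
  simp only [unipotentAdjoint, add_sub_cancel_left]
  have h : t • (1 + Z) - 1 = (t - 1) • 1 + t • Z := by module
  rw [h]
  simp only [add_mul, mul_add, mul_sub, smul_mul_assoc, mul_smul_comm, one_mul, mul_one,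
    ← sq, ← pow_succ', hB, smul_zero]
  module

theorem exists_smul_sub_one_mul_unipotentAdjoint {R S : Type*} [CommRing R] [Ring S] [Algebra R S]
    (t : R) (A B : S) :
    ∃ F, (t • A - 1) * unipotentAdjoint t B = (A - 1) * (B - 1) ^ 2 + (t - 1) • F := by
  refine ⟨A * unipotentAdjoint t B +
    (A - 1) * ((t - 1) • 1 - t • (B - 1) + (t + 1) • (B - 1) ^ 2), ?_⟩
  simp only [unipotentAdjoint, sub_mul, one_mul, mul_add, mul_sub, smul_mul_assoc, mul_smul_comm,
    mul_one]
  module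

/-- Cramer's rule. -/
theorem dvd_det_mul_of_mul_eq_smul {ι R : Type*} [Fintype ι] [DecidableEq ι] [CommRing R]
    {M E F : Matrix ι ι R} {r : R} (h : M * E = r • F) (i j : ι) : r ∣ M.det * E i j := by
  have hadj := congrArg (M.adjugate * ·) h
  rw [← mul_assoc, Matrix.adjugate_mul, Matrix.smul_mul, one_mul, Matrix.mul_smul] at hadj
  exact ⟨_, congrFun (congrFun hadj i) j⟩

theorem Phi_fox_relator_mul_add (ρ : KnotGroup k n →* SL(2, ℂ)) :
    Phi ρ (fox 0 (relator k n)) * ((T 1 : ℂ[T;T⁻¹]) • C.mapMatrix (AdRep ρ fa) - 1) +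
      Phi ρ (fox 1 (relator k n)) * ((T 1 : ℂ[T;T⁻¹]) • C.mapMatrix (AdRep ρ fb) - 1) = 0 := by
  have h := congrArg (Phi ρ) (sum_fox_mul_of_sub_one (relator k n))
  simp only [Fin.sum_univ_two, map_add, map_mul (Phi ρ), map_sub, map_one] at h
  rwa [← fa, ← fb, Phi_of_eq_T_smul ρ abel_proj_fa, Phi_of_eq_T_smul ρ abel_proj_fb, Phi_of,
    proj_relator, map_one, sub_self] at h

theorem one_sub_T_pow_three_dvd (hρ : IsParabolic ρ) :
    (1 - T 1 : ℂ[T;T⁻¹]) ^ 3 ∣ (Phi ρ (fox 0 (relator k n))).det := by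
  set t : ℂ[T;T⁻¹] := T 1
  let const := (C : ℂ →+* ℂ[T;T⁻¹]).mapMatrix (m := Fin 3)
  set A := AdRep ρ fa
  set B := AdRep ρ fb
  set K : Matrix (Fin 3) (Fin 3) ℂ := (A - 1) * (B - 1) ^ 2
  set E := (t • const A - 1) * unipotentAdjoint t (const B) with hE
  have hB : (const B - 1) ^ 3 = 0 := by
    have h : (B - 1) ^ 3 = 0 := Ad_sub_one_pow_three hρ.trace_fb_sq
    rw [← map_one const, ← map_sub, ← map_pow, h, map_zero]
  have hdvd (i j) : (t - 1) ^ 3 ∣ (Phi ρ (fox 0 (relator k n))).det * E i j := by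
    refine dvd_det_mul_of_mul_eq_smul (F := -Phi ρ (fox 1 (relator k n))) ?_ i j
    rw [← mul_assoc, eq_neg_of_add_eq_zero_left (Phi_fox_relator_mul_add ρ), neg_mul, mul_assoc,
      smul_sub_one_mul_unipotentAdjoint t hB, Matrix.mul_smul, mul_one, smul_neg]
  obtain ⟨i, j, hK⟩ : ∃ i j, K i j ≠ 0 := by
    by_contra! h
    exact Ad_sub_one_mul_sq_ne_zero hρ.trace_fb_sq hρ.1.not_commute (Matrix.ext h)
  have hcoprime : IsCoprime (t - 1) (E i j) := by
    obtain ⟨F, hF⟩ := exists_smul_sub_one_mul_unipotentAdjoint t (const A) (const B)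
    have hEK : E i j = C (K i j) + (t - 1) * F i j := by
      rw [hE, hF, ← map_one const, ← map_sub, ← map_sub, ← map_pow, ← map_mul]
      rfl
    rw [hEK, IsCoprime.add_mul_left_right_iff]
    exact isCoprime_one_right.of_isCoprime_of_dvd_right
      ((isUnit_iff_ne_zero.2 hK).map C).dvd
  rw [← neg_sub, Odd.neg_pow (by decide), neg_dvd]
  exact hcoprime.pow_left.dvd_of_dvd_mul_right (hdvd i j)

theorem det_Phi_one_sub (hρ : IsParabolic ρ) :
    (Phi ρ (1 - of ℤ _ fb)).det = (1 - T 1) ^ 3 := by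
  rw [map_sub, map_one, Phi_of_eq_T_smul ρ abel_proj_fb, AdRep, MonoidHom.comp_apply,
    det_one_sub_smul_Ad, MonoidHom.comp_apply, ← map_pow, hρ.trace_fb_sq, map_ofNat]
  ring

theorem hasExtremeTerms_adjointAlexander (hρ : IsParabolic ρ) {d e : ℤ} {c c' : ℂ}
    {L L' : Matrix (Fin 3) (Fin 3) ℂ}
    (hL : HasLeadingTerm (-1) (Phi ρ (fox 0 (relator k n))) d L) (hc : L.det = -c) (hc0 : c ≠ 0)
    (hL' : HasLeadingTerm 1 (Phi ρ (fox 0 (relator k n))) e L') (hc' : L'.det = c')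
    (hc'0 : c' ≠ 0) : HasExtremeTerms (adjointAlexander ρ) (3 * d - 3) c (3 * e) c' := by
  obtain ⟨P, hP⟩ := one_sub_T_pow_three_dvd hρ
  have htop := hL.hasHighestTerm_det
  have hbot := hL'.hasLowestTerm_det
  rw [hP, hc] at htop
  rw [hP, hc'] at hbot
  have hne : (1 - T 1 : ℂ[T;T⁻¹]) ^ 3 ≠ 0 := fun h =>
    neg_ne_zero.2 hc0 (by rw [← htop.1, h, zero_mul]; rfl)
  have htop := htop.of_one_sub_T_pow_mul
  have hbot := hbot.of_one_sub_T_pow_mul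
  rw [Fintype.card_fin] at htop hbot
  refine ⟨P, ?_, ⟨htop.1.trans (by ring), hc0, htop.2⟩, ⟨hbot.1, hc'0, hbot.2⟩⟩
  rw [adjointAlexander, det_Phi_one_sub hρ, hP, map_mul, mul_div_cancel_left₀]
  exact (map_ne_zero_iff _ (FaithfulSMul.algebraMap_injective _ _)).2 hne

end TwistedFox

/-! ### Nonvanishing of the Chebyshev factors -/

section Nonvanishing

theorem coe_pow_eq_smul_one {V : SL(2, ℂ)} {m : ℕ} (h : chebS (m - 1) V.1.trace = 0) :
    (V ^ m).1 = (-chebS (m - 2) V.1.trace) • 1 := by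
  rw [Matrix.SpecialLinearGroup.coe_pow, pow_eq_chebyshev V.2, ← chebS, h, zero_smul, zero_sub,
    ← neg_smul, chebS]

theorem trace_mul_inv_add_trace_mul {R : Type*} [CommRing R] (A B : SL(2, R)) :
    (B * A⁻¹).1.trace + (B * A).1.trace = B.1.trace * A.1.trace := by
  rw [Matrix.SpecialLinearGroup.coe_mul, Matrix.SpecialLinearGroup.coe_mul,
    coe_inv_eq_trace_smul_one_sub, mul_sub, Matrix.mul_smul, mul_one, Matrix.trace_sub,
    Matrix.trace_smul, smul_eq_mul]
  ring

theorem chebS_sub_smul_sub_eq_zero {A B : SL(2, ℂ)} (htr : B.1.trace = A.1.trace) {m : ℕ}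
    (h : SemiconjBy ((B * A) ^ m) A B) :
    (chebS (m - 1) (B * A).1.trace - chebS (m - 2) (B * A).1.trace) • (A.1 - B.1) = 0 := by
  have hBA : (B * A).1 = B.1 * A.1 := Matrix.SpecialLinearGroup.coe_mul B A
  have hcomm : B.1 * A.1 * A.1 - B.1 * (B.1 * A.1) = A.1 - B.1 := by
    rw [mul_assoc, mul_self_of_det_eq_one A.2, ← mul_assoc, mul_self_of_det_eq_one B.2, htr,
      mul_sub, sub_mul, Matrix.mul_smul, Matrix.smul_mul, mul_one, one_mul]
    abel
  have hrel := congrArg Subtype.val h.eq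
  rw [Matrix.SpecialLinearGroup.coe_mul, Matrix.SpecialLinearGroup.coe_mul,
    Matrix.SpecialLinearGroup.coe_pow, pow_eq_chebyshev (B * A).2, ← chebS, ← chebS, hBA, sub_mul,
    mul_sub, Matrix.smul_mul, Matrix.smul_mul, Matrix.mul_smul, Matrix.mul_smul, one_mul,
    mul_one] at hrel
  rw [sub_smul, hBA]
  nth_rw 1 [← hcomm]
  rw [smul_sub, smul_sub, sub_sub_sub_comm, hrel, sub_self]

variable {k N : ℕ} {ρ : KnotGroup k (N : ℤ) →* SL(2, ℂ)}

theorem semiconjBy_map_word (ρ : KnotGroup k (N : ℤ) →* SL(2, ℂ)) :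
    SemiconjBy (ρ (proj k N (word k)) ^ N) (ρ (proj k N fa)) (ρ (proj k N fb)) := by
  simpa only [zpow_natCast, map_pow] using (semiconjBy_proj_word (k := k) (n := N)).map ρ

theorem IsNonabelian.not_commute_word (hρ : IsNonabelian ρ) :
    ¬Commute (ρ (proj k N (word k)) ^ N) (ρ (proj k N fa)) := by
  intro h
  have hab := mul_right_cancel (h.eq.symm.trans (semiconjBy_map_word ρ).eq)
  exact hρ.not_commute (hab ▸ .refl _)

theorem trace_fb_mul_fa_inv (ρ : KnotGroup k (N : ℤ) →* SL(2, ℂ)) :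
    (ρ (proj k N (fb * fa⁻¹))).1.trace = trY ρ := by
  rw [trY, ← trace_inv, ← map_inv, ← map_inv, mul_inv_rev, inv_inv]

theorem trace_fb_inv_mul_fa (ρ : KnotGroup k (N : ℤ) →* SL(2, ℂ)) :
    (ρ (proj k N (fb⁻¹ * fa))).1.trace = trY ρ := by
  rw [trY, ← trace_conj (ρ (proj k N fb⁻¹)) (ρ (proj k N (fa * fb⁻¹))), ← map_inv, ← map_inv,
    ← map_mul, ← map_mul, ← map_mul, ← map_mul]
  group

theorem IsNonabelian.chebS_trZ_ne_zero (hρ : IsNonabelian ρ) : chebS (N - 1) (trZ ρ) ≠ 0 :=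
  fun h => hρ.not_commute_word (commute_of_eq_smul_one (coe_pow_eq_smul_one h) _)

theorem IsNonabelian.chebS_trY_ne_zero_even {m : ℕ} {ρ : KnotGroup (2 * m) (N : ℤ) →* SL(2, ℂ)}
    (hρ : IsNonabelian ρ) : chebS (m - 1) (trY ρ) ≠ 0 := by
  intro h
  refine hρ.not_commute_word (Commute.pow_left ?_ _)
  rw [word_eq_wordIn, wordIn_two_mul, mul_one, map_mul, map_mul, map_pow, map_pow, map_pow, map_pow]
  have hc := coe_pow_eq_smul_one ((congrArg _ (trace_fb_mul_fa_inv ρ)).trans h)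
  have hd := coe_pow_eq_smul_one ((congrArg _ (trace_fb_inv_mul_fa ρ)).trans h)
  exact (commute_of_eq_smul_one hc _).mul_left (commute_of_eq_smul_one hd _)

theorem map_word_of_chebS_trY_eq_zero {m : ℕ} {ρ : KnotGroup (2 * m + 1) (N : ℤ) →* SL(2, ℂ)}
    (h : chebS (m - 1) (trY ρ) = 0) : ρ (proj _ N (word (2 * m + 1))) = ρ (proj _ N (fb * fa)) := by
  have hc := coe_pow_eq_smul_one ((congrArg _ (trace_fb_mul_fa_inv ρ)).trans h)
  have hd := coe_pow_eq_smul_one ((congrArg _ (trace_fb_inv_mul_fa ρ)).trans h)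
  rw [trace_fb_mul_fa_inv] at hc
  rw [trace_fb_inv_mul_fa] at hd
  have hs : -chebS (m - 2) (trY ρ) * -chebS (m - 2) (trY ρ) = 1 := by
    have := (ρ (proj _ N (fb * fa⁻¹)) ^ m).2
    rwa [hc, Matrix.det_smul, Matrix.det_one, Fintype.card_fin, mul_one, sq] at this
  apply Subtype.ext
  rw [word_eq_wordIn, wordIn_two_mul_add_one, map_mul, map_mul, map_pow, map_mul, map_mul, map_pow,
    map_pow, map_pow, Matrix.SpecialLinearGroup.coe_mul, Matrix.SpecialLinearGroup.coe_mul, hc, hd,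
    Matrix.smul_mul, one_mul, Matrix.smul_mul, Matrix.mul_smul, mul_one, smul_smul, hs, one_smul]

/-- If `S_{m-1}(y)` vanished, then `Re y < 2`, and `w` would act as `ba`, so that `Re z ≤ 2` by the
relation of the group; but `y + z = (tr a)²` is `4`. -/
theorem IsParabolic.chebS_trY_ne_zero_odd {m : ℕ} (hm : m ≠ 0) (hN : N ≠ 0)
    {ρ : KnotGroup (2 * m + 1) (N : ℤ) →* SL(2, ℂ)} (hρ : IsParabolic ρ) :
    chebS (m - 1) (trY ρ) ≠ 0 := by
  intro h
  obtain ⟨M, rfl⟩ := Nat.exists_eq_succ_of_ne_zero hN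
  have hword := map_word_of_chebS_trY_eq_zero h
  set A := ρ (proj _ _ fa) with hA
  set B := ρ (proj _ _ fb) with hB
  rw [map_mul, map_mul, ← hA, ← hB] at hword
  have hBA : (B * A).1.trace = trZ ρ := by rw [trZ, hword]
  have hyz : trY ρ + trZ ρ = 4 := by
    rw [← trace_fb_mul_fa_inv, ← hBA, map_mul, map_mul, map_inv, map_inv,
      trace_mul_inv_add_trace_mul, ← hρ.trace_fb_sq, ← trace_fb ρ, sq]
  have hsemi := semiconjBy_map_word ρ
  rw [hword] at hsemi
  have hzero := chebS_sub_smul_sub_eq_zero (trace_fb ρ) hsemi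
  rw [hBA, smul_eq_zero, sub_eq_zero, sub_eq_zero] at hzero
  rcases hzero with hz | hAB
  · push_cast at hz
    rw [add_sub_cancel_right, show (M : ℤ) + 1 - 2 = M - 1 by ring] at hz
    have hyre := re_lt_two_of_chebS_eq_zero hm h
    have hzre := re_le_two_of_chebS_eq hz
    have hyzre := congrArg Complex.re hyz
    rw [Complex.add_re, Complex.re_ofNat] at hyzre
    linarith
  · exact hρ.1.not_commute (Subtype.ext hAB ▸ .refl _)

end Nonvanishing

/-! ### The extreme terms for parabolic representations -/

section ParabolicExtremeTerms

open MonoidAlgebra (of)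

variable {k : ℕ} {n : ℤ}

theorem abel_proj_fb_inv : abel k n (proj k n fb⁻¹) = Multiplicative.ofAdd (-1) := by
  rw [map_inv, map_inv, abel_proj_fb, ofAdd_neg]

theorem abel_proj_fb_mul_fa_inv : abel k n (proj k n (fb * fa⁻¹)) = Multiplicative.ofAdd 0 := by
  rw [map_mul, map_mul, map_inv, map_inv, abel_proj_fa, abel_proj_fb, mul_inv_cancel, ofAdd_zero]

theorem abel_proj_fb_inv_mul_fa : abel k n (proj k n (fb⁻¹ * fa)) = Multiplicative.ofAdd 0 := by
  rw [map_mul, map_mul, map_inv, map_inv, abel_proj_fa, abel_proj_fb, inv_mul_cancel, ofAdd_zero]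

theorem abel_proj_fb_mul_fa : abel k n (proj k n (fb * fa)) = Multiplicative.ofAdd 2 := by
  rw [map_mul, map_mul, abel_proj_fa, abel_proj_fb]
  rfl

theorem abel_proj_word_two_mul (m : ℕ) :
    abel (2 * m) n (proj _ n (word (2 * m))) = Multiplicative.ofAdd 0 := by
  rw [word_eq_wordIn, wordIn_two_mul, mul_one, map_mul, map_mul, map_pow, map_pow, map_pow, map_pow,
    abel_proj_fb_mul_fa_inv, abel_proj_fb_inv_mul_fa, ofAdd_zero, one_pow, one_mul]

theorem abel_proj_word_two_mul_add_one (m : ℕ) :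
    abel (2 * m + 1) n (proj _ n (word (2 * m + 1))) = Multiplicative.ofAdd 2 := by
  rw [word_eq_wordIn, wordIn_two_mul_add_one, map_mul, map_mul, map_mul, map_mul, map_pow, map_pow,
    map_pow, map_pow, abel_proj_fb_mul_fa_inv, abel_proj_fb_inv_mul_fa, abel_proj_fb_mul_fa,
    ofAdd_zero, one_pow, one_mul, mul_one]

theorem HasLeadingTerm.one_sub_Phi_fb_zero (ρ : KnotGroup k n →* SL(2, ℂ)) :
    HasLeadingTerm 1 (1 - Phi ρ (of ℤ _ fb)) 0 1 := by
  have hb := ((HasLeadingTerm.Phi_of ρ 1 abel_proj_fb).weaken (d' := 0) one_ne_zero rfl).neg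
  simpa only [sub_eq_add_neg, neg_zero, add_zero] using HasLeadingTerm.one.add hb

theorem HasLeadingTerm.one_sub_Phi_fb_one (ρ : KnotGroup k n →* SL(2, ℂ)) :
    HasLeadingTerm (-1) (1 - Phi ρ (of ℤ _ fb)) 1 (-AdRep ρ fb) := by
  have hone := HasLeadingTerm.one (ι := Fin 3) (R := ℂ) (σ := -1)
  simpa only [sub_eq_add_neg, zero_add] using
    (hone.weaken (d' := 1) one_ne_zero rfl).add (HasLeadingTerm.Phi_of ρ (-1) abel_proj_fb).neg

section Even

variable {m N : ℕ} (ρ : KnotGroup (2 * m) (N : ℤ) →* SL(2, ℂ))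

theorem Phi_fox_word_two_mul :
    Phi ρ (fox 0 (word (2 * m))) =
      -((∑ i ∈ Finset.range m, Phi ρ (of ℤ _ (fb * fa⁻¹)) ^ i) * Phi ρ (of ℤ _ (fb * fa⁻¹))) +
        Phi ρ (of ℤ _ (fb * fa⁻¹)) ^ m *
          ((∑ i ∈ Finset.range m, Phi ρ (of ℤ _ (fb⁻¹ * fa)) ^ i) * Phi ρ (of ℤ _ fb⁻¹)) := by
  rw [word_eq_wordIn, wordIn_two_mul, fox_conj_mul_conj, fox_one, zero_add, map_one, one_mul]
  simp only [map_add, map_neg, map_mul (Phi ρ), map_sum, map_pow (Phi ρ)]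

theorem hasLeadingTerm_Phi_fox_word_two_mul_zero :
    HasLeadingTerm 1 (Phi ρ (fox 0 (word (2 * m)))) (-1)
      (AdRep ρ (fb * fa⁻¹) ^ m *
        ((∑ i ∈ Finset.range m, AdRep ρ (fb⁻¹ * fa) ^ i) * AdRep ρ fb⁻¹)) := by
  have hc := HasLeadingTerm.Phi_of ρ 1 abel_proj_fb_mul_fa_inv
  have hd := HasLeadingTerm.Phi_of ρ 1 abel_proj_fb_inv_mul_fa
  have hb := HasLeadingTerm.Phi_of ρ 1 abel_proj_fb_inv
  have hleft := ((hc.geom_sum_zero m).mul hc).neg.weaken (d' := -1) one_ne_zero rfl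
  have hright := (hc.pow m).mul ((hd.geom_sum_zero m).mul hb)
  rw [Phi_fox_word_two_mul]
  simpa only [mul_zero, zero_add] using hleft.add (by simpa only [mul_zero, zero_add] using hright)

theorem hasLeadingTerm_Phi_fox_word_two_mul_infty :
    HasLeadingTerm (-1) (Phi ρ (fox 0 (word (2 * m)))) 0
      (-((∑ i ∈ Finset.range m, AdRep ρ (fb * fa⁻¹) ^ i) * AdRep ρ (fb * fa⁻¹))) := by
  have hc := HasLeadingTerm.Phi_of ρ (-1) abel_proj_fb_mul_fa_inv
  have hd := HasLeadingTerm.Phi_of ρ (-1) abel_proj_fb_inv_mul_fa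
  have hb := HasLeadingTerm.Phi_of ρ (-1) abel_proj_fb_inv
  have hleft := ((hc.geom_sum_zero m).mul hc).neg
  have hright := ((hc.pow m).mul ((hd.geom_sum_zero m).mul hb)).weaken (d' := 0) one_ne_zero
    (by simp)
  rw [Phi_fox_word_two_mul]
  simpa only [add_zero] using hleft.add hright

theorem hasLeadingTerm_Phi_fox_relator_two_mul_zero :
    HasLeadingTerm 1 (Phi ρ (fox 0 (relator (2 * m) N))) (-1)
      (1 * (∑ i ∈ Finset.range N, AdRep ρ (word (2 * m)) ^ i) *
        (AdRep ρ (fb * fa⁻¹) ^ m *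
          ((∑ i ∈ Finset.range m, AdRep ρ (fb⁻¹ * fa) ^ i) * AdRep ρ fb⁻¹))) := by
  have hw := HasLeadingTerm.Phi_of ρ 1 (abel_proj_word_two_mul m)
  have hpow := (hw.pow N).weaken (d' := -1) one_ne_zero (by rw [mul_zero]; rfl)
  have hmain := ((HasLeadingTerm.one_sub_Phi_fb_zero ρ).mul (hw.geom_sum_zero N)).mul
    (hasLeadingTerm_Phi_fox_word_two_mul_zero ρ)
  rw [zero_add, zero_add] at hmain
  simpa only [Phi_fox_relator, zero_add] using hpow.add hmain

theorem hasLeadingTerm_Phi_fox_relator_two_mul_infty :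
    HasLeadingTerm (-1) (Phi ρ (fox 0 (relator (2 * m) N))) 1
      (-AdRep ρ fb * (∑ i ∈ Finset.range N, AdRep ρ (word (2 * m)) ^ i) *
        -((∑ i ∈ Finset.range m, AdRep ρ (fb * fa⁻¹) ^ i) * AdRep ρ (fb * fa⁻¹))) := by
  have hw := HasLeadingTerm.Phi_of ρ (-1) (abel_proj_word_two_mul m)
  have hpow := (hw.pow N).weaken (d' := 1) one_ne_zero (by rw [mul_zero]; rfl)
  have hmain := ((HasLeadingTerm.one_sub_Phi_fb_one ρ).mul (hw.geom_sum_zero N)).mul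
    (hasLeadingTerm_Phi_fox_word_two_mul_infty ρ)
  rw [add_zero, add_zero] at hmain
  simpa only [Phi_fox_relator, zero_add] using hpow.add hmain

theorem hasExtremeTerms_even (hm : m ≠ 0) (hN : N ≠ 0) (hρ : IsParabolic ρ) :
    HasExtremeTerms (adjointAlexander ρ)
      0 (-(m * N * chebS (m - 1) (trY ρ) ^ 2 * chebS (N - 1) (trZ ρ) ^ 2))
      (-3) (m * N * chebS (m - 1) (trY ρ) ^ 2 * chebS (N - 1) (trZ ρ) ^ 2) := by
  have hcoeff : (m * N * chebS (m - 1) (trY ρ) ^ 2 * chebS (N - 1) (trZ ρ) ^ 2 : ℂ) ≠ 0 :=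
    mul_ne_zero (mul_ne_zero (mul_ne_zero (Nat.cast_ne_zero.2 hm) (Nat.cast_ne_zero.2 hN))
      (pow_ne_zero 2 hρ.1.chebS_trY_ne_zero_even)) (pow_ne_zero 2 hρ.1.chebS_trZ_ne_zero)
  have hdetZ : (∑ i ∈ Finset.range N, AdRep ρ (word (2 * m)) ^ i).det =
      N * chebS (N - 1) (trZ ρ) ^ 2 := det_sum_AdRep_pow ρ _ N
  refine hasExtremeTerms_adjointAlexander hρ
    (hasLeadingTerm_Phi_fox_relator_two_mul_infty ρ) ?_ (neg_ne_zero.2 hcoeff)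
    (hasLeadingTerm_Phi_fox_relator_two_mul_zero ρ) ?_ hcoeff
  · simp only [Matrix.det_mul, Matrix.det_neg, det_AdRep, hdetZ, det_sum_AdRep_pow,
      trace_fb_mul_fa_inv, Fintype.card_fin]
    ring
  · simp only [Matrix.det_mul, Matrix.det_one, Matrix.det_pow, det_AdRep, hdetZ,
      det_sum_AdRep_pow, trace_fb_inv_mul_fa]
    ring

end Even

section Odd

section

variable {m : ℕ} (ρ : KnotGroup (2 * m + 1) n →* SL(2, ℂ))

theorem Phi_fox_word_two_mul_add_one :
    Phi ρ (fox 0 (word (2 * m + 1))) =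
      -((∑ i ∈ Finset.range m, Phi ρ (of ℤ _ (fb * fa⁻¹)) ^ i) * Phi ρ (of ℤ _ (fb * fa⁻¹))) +
        Phi ρ (of ℤ _ (fb * fa⁻¹)) ^ m * (Phi ρ (of ℤ _ fb) + Phi ρ (of ℤ _ (fb * fa)) *
          ((∑ i ∈ Finset.range m, Phi ρ (of ℤ _ (fb⁻¹ * fa)) ^ i) * Phi ρ (of ℤ _ fb⁻¹))) := by
  have hba : fox 0 (fb * fa) = of ℤ _ fb := by rw [fox_mul, fox_fb, fox_fa, zero_add, mul_one]
  rw [word_eq_wordIn, wordIn_two_mul_add_one, fox_conj_mul_conj, hba]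
  simp only [map_add, map_neg, map_mul (Phi ρ), map_sum, map_pow (Phi ρ)]

theorem hasLeadingTerm_Phi_fb_mul_fa_mul (σ : ℤ) :
    HasLeadingTerm σ (Phi ρ (of ℤ _ (fb * fa⁻¹)) ^ m *
      (Phi ρ (of ℤ _ fb) + Phi ρ (of ℤ _ (fb * fa)) *
        ((∑ i ∈ Finset.range m, Phi ρ (of ℤ _ (fb⁻¹ * fa)) ^ i) * Phi ρ (of ℤ _ fb⁻¹)))) 1
      (AdRep ρ (fb * fa⁻¹) ^ m * (AdRep ρ fb + AdRep ρ (fb * fa) *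
        ((∑ i ∈ Finset.range m, AdRep ρ (fb⁻¹ * fa) ^ i) * AdRep ρ fb⁻¹))) := by
  have hc := (HasLeadingTerm.Phi_of ρ σ abel_proj_fb_mul_fa_inv).pow m
  have hd := (HasLeadingTerm.Phi_of ρ σ abel_proj_fb_inv_mul_fa).geom_sum_zero m
  have hdb := (HasLeadingTerm.Phi_of ρ σ abel_proj_fb_mul_fa).mul
    (hd.mul (HasLeadingTerm.Phi_of ρ σ abel_proj_fb_inv))
  have hsum := (HasLeadingTerm.Phi_of ρ σ abel_proj_fb).add hdb
  simpa only [mul_zero, zero_add] using hc.mul hsum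

theorem hasLeadingTerm_Phi_fox_word_two_mul_add_one_zero :
    HasLeadingTerm 1 (Phi ρ (fox 0 (word (2 * m + 1)))) 0
      (-((∑ i ∈ Finset.range m, AdRep ρ (fb * fa⁻¹) ^ i) * AdRep ρ (fb * fa⁻¹))) := by
  have hc := HasLeadingTerm.Phi_of ρ 1 abel_proj_fb_mul_fa_inv
  have hleft := ((hc.geom_sum_zero m).mul hc).neg
  have hright := (hasLeadingTerm_Phi_fb_mul_fa_mul ρ 1).weaken (d' := 0) one_ne_zero rfl
  rw [Phi_fox_word_two_mul_add_one]
  simpa only [add_zero] using hleft.add hright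

theorem hasLeadingTerm_Phi_fox_word_two_mul_add_one_infty :
    HasLeadingTerm (-1) (Phi ρ (fox 0 (word (2 * m + 1)))) 1
      (AdRep ρ (fb * fa⁻¹) ^ m * (AdRep ρ fb + AdRep ρ (fb * fa) *
        ((∑ i ∈ Finset.range m, AdRep ρ (fb⁻¹ * fa) ^ i) * AdRep ρ fb⁻¹))) := by
  have hc := HasLeadingTerm.Phi_of ρ (-1) abel_proj_fb_mul_fa_inv
  have hleft := ((hc.geom_sum_zero m).mul hc).neg.weaken (d' := 1) one_ne_zero rfl
  rw [Phi_fox_word_two_mul_add_one]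
  simpa only [zero_add] using hleft.add (hasLeadingTerm_Phi_fb_mul_fa_mul ρ (-1))

end

theorem wordIn_pow_add_one_of_semiconjBy {G : Type*} [Group G] {m M : ℕ} {a b : G}
    (h : SemiconjBy (wordIn (2 * m + 1) a b ^ (M + 1)) a b) :
    wordIn (2 * m + 1) a b ^ (M + 1) =
      b * wordIn (2 * m + 1) a b ^ M * (b * a⁻¹) ^ m * b * (a * b⁻¹) ^ m := by
  have hconj : (a * b⁻¹) ^ m = a * (b⁻¹ * a) ^ m * a⁻¹ := by rw [← conj_pow]; group
  rw [eq_mul_inv_of_mul_eq h.eq, pow_succ, hconj]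
  nth_rw 2 [wordIn_two_mul_add_one]
  group

variable {m M : ℕ} (ρ : KnotGroup (2 * m + 1) ((M + 1 : ℕ) : ℤ) →* SL(2, ℂ))

theorem proj_word_pow_add_one :
    proj (2 * m + 1) (M + 1 : ℕ) (word (2 * m + 1)) ^ (M + 1) =
      proj _ _ fb * proj _ _ (word (2 * m + 1)) ^ M * proj _ _ (fb * fa⁻¹) ^ m * proj _ _ fb *
        proj _ _ (fa * fb⁻¹) ^ m := by
  simp only [map_mul, map_inv, word_eq_wordIn, map_wordIn]
  apply wordIn_pow_add_one_of_semiconjBy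
  simpa only [zpow_natCast, word_eq_wordIn, map_wordIn] using
    semiconjBy_proj_word (k := 2 * m + 1) (n := (M + 1 : ℕ))

theorem AdRep_word_pow_add_one :
    AdRep ρ (word (2 * m + 1)) ^ (M + 1) =
      AdRep ρ fb * AdRep ρ (word (2 * m + 1)) ^ M * AdRep ρ (fb * fa⁻¹) ^ m * AdRep ρ fb *
        AdRep ρ (fa * fb⁻¹) ^ m := by
  have h := congrArg (Ad.comp ρ) (proj_word_pow_add_one (m := m) (M := M))
  simp only [map_mul (Ad.comp ρ), map_pow (Ad.comp ρ)] at h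
  exact h

theorem hasLeadingTerm_Phi_fox_relator_two_mul_add_one_zero :
    HasLeadingTerm 1 (Phi ρ (fox 0 (relator (2 * m + 1) (M + 1 : ℕ)))) 0
      (-((∑ i ∈ Finset.range m, AdRep ρ (fb * fa⁻¹) ^ i) * AdRep ρ (fb * fa⁻¹))) := by
  have hw := HasLeadingTerm.Phi_of ρ 1 (abel_proj_word_two_mul_add_one m)
  have hpow := (hw.pow (M + 1)).weaken (n := (M + 1) * 2) (d' := 0) (by simp) (by simp)
  have hmain := ((HasLeadingTerm.one_sub_Phi_fb_zero ρ).mul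
    (hw.geom_sum_const (k := 2) two_ne_zero M)).mul
      (hasLeadingTerm_Phi_fox_word_two_mul_add_one_zero ρ)
  simpa only [Phi_fox_relator, zero_add, one_mul] using hpow.add hmain

theorem hasLeadingTerm_Phi_fox_relator_two_mul_add_one_infty :
    HasLeadingTerm (-1) (Phi ρ (fox 0 (relator (2 * m + 1) (M + 1 : ℕ)))) (2 * M + 2)
      (-(AdRep ρ fb * AdRep ρ (word (2 * m + 1)) ^ M * AdRep ρ (fb * fa⁻¹) ^ m * AdRep ρ fb *
        ∑ i ∈ Finset.range m, AdRep ρ (fa * fb⁻¹) ^ i)) := by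
  set E := AdRep ρ (fa * fb⁻¹)
  set D := AdRep ρ (fb⁻¹ * fa)
  have hsum : AdRep ρ (fb * fa) * ((∑ i ∈ Finset.range m, D ^ i) * AdRep ρ fb⁻¹) =
      AdRep ρ fb * ((∑ i ∈ Finset.range m, E ^ i) * E) := by
    have hAD : SemiconjBy (AdRep ρ fa) D E := by
      rw [SemiconjBy, ← map_mul, ← map_mul]
      group
    have hA : AdRep ρ fa * AdRep ρ fb⁻¹ = E := (map_mul _ _ _).symm
    rw [map_mul, mul_assoc, ← mul_assoc (AdRep ρ fa), Finset.mul_sum,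
      Finset.sum_congr rfl fun i _ => (hAD.pow_right i).eq, ← Finset.sum_mul, mul_assoc, hA]
  have hw := HasLeadingTerm.Phi_of ρ (-1) (abel_proj_word_two_mul_add_one m)
  have hpow := hw.pow (M + 1)
  have hmain := ((HasLeadingTerm.one_sub_Phi_fb_one ρ).mul
    (hw.geom_sum (k := 2) two_ne_zero M)).mul
      (hasLeadingTerm_Phi_fox_word_two_mul_add_one_infty ρ)
  rw [show ((M + 1 : ℕ) * 2 : ℤ) = 2 * M + 2 by push_cast; ring] at hpow
  rw [show (1 + (M : ℤ) * -((2 : ℕ) * -1) + 1) = 2 * M + 2 by push_cast; ring] at hmain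
  rw [Phi_fox_relator]
  convert hpow.add hmain using 1
  rw [AdRep_word_pow_add_one, hsum, ← sub_add_cancel (E ^ m) 1, ← geom_sum_mul]
  noncomm_ring

theorem hasExtremeTerms_odd (hm : m ≠ 0) (hρ : IsParabolic ρ) :
    HasExtremeTerms (adjointAlexander ρ) (3 * (2 * M + 2) - 3) (m * chebS (m - 1) (trY ρ) ^ 2)
      0 (-(m * chebS (m - 1) (trY ρ) ^ 2)) := by
  have hcoeff : (m * chebS (m - 1) (trY ρ) ^ 2 : ℂ) ≠ 0 := mul_ne_zero (Nat.cast_ne_zero.2 hm)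
    (pow_ne_zero 2 (hρ.chebS_trY_ne_zero_odd hm M.succ_ne_zero))
  have hdetE : (∑ i ∈ Finset.range m, AdRep ρ (fa * fb⁻¹) ^ i).det =
      m * chebS (m - 1) (trY ρ) ^ 2 := det_sum_AdRep_pow ρ _ m
  refine hasExtremeTerms_adjointAlexander hρ
    (hasLeadingTerm_Phi_fox_relator_two_mul_add_one_infty ρ) ?_ hcoeff
    (hasLeadingTerm_Phi_fox_relator_two_mul_add_one_zero ρ) ?_ (neg_ne_zero.2 hcoeff)
  · simp only [Matrix.det_mul, Matrix.det_neg, Matrix.det_pow, det_AdRep, hdetE, Fintype.card_fin]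
    ring
  · simp only [Matrix.det_mul, Matrix.det_neg, det_AdRep, det_sum_AdRep_pow, trace_fb_mul_fa_inv,
      Fintype.card_fin]
    ring

end Odd

section One

variable {M : ℕ} (ρ : KnotGroup 1 ((M + 2 : ℕ) : ℤ) →* SL(2, ℂ))

theorem Phi_fox_relator_one :
    Phi ρ (fox 0 (relator 1 (M + 2 : ℕ))) =
      (∑ i ∈ Finset.range (M + 2), Phi ρ (of ℤ _ (word 1)) ^ i) * Phi ρ (of ℤ _ fb) -
        Phi ρ (of ℤ _ fb) * (∑ i ∈ Finset.range (M + 1), Phi ρ (of ℤ _ (word 1)) ^ i) *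
          Phi ρ (of ℤ _ fb) := by
  have hword : fox 0 (word 1) = of ℤ _ fb := by
    rw [word_eq_wordIn, show wordIn 1 fa fb = _ from wordIn_two_mul_add_one 0 fa fb, pow_zero,
      pow_zero, one_mul, mul_one, fox_mul, fox_fb, fox_fa, zero_add, mul_one]
  have hpow : Phi ρ (of ℤ _ (word 1)) ^ (M + 2) =
      Phi ρ (of ℤ _ fb) * Phi ρ (of ℤ _ (word 1)) ^ (M + 1) * Phi ρ (of ℤ _ fb) := by
    have h := congrArg (tensorRep ρ) (proj_word_pow_add_one (m := 0) (M := M + 1))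
    simpa only [Phi_of, map_mul (tensorRep ρ), map_pow (tensorRep ρ), pow_zero, mul_one] using h
  rw [Phi_fox_relator, hpow, hword, Finset.sum_range_succ _ (M + 1)]
  noncomm_ring

theorem hasLeadingTerm_Phi_fox_relator_one_zero :
    HasLeadingTerm 1 (Phi ρ (fox 0 (relator 1 (M + 2 : ℕ)))) 1 (AdRep ρ fb) := by
  have hw := HasLeadingTerm.Phi_of ρ 1 (abel_proj_word_two_mul_add_one 0)
  have hb := HasLeadingTerm.Phi_of ρ 1 abel_proj_fb
  have hmain := (hw.geom_sum_const (k := 2) two_ne_zero (M + 1)).mul hb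
  have hrest := ((hb.mul (hw.geom_sum_const (k := 2) two_ne_zero M)).mul hb).neg.weaken
    (d' := 1) one_ne_zero rfl
  rw [Phi_fox_relator_one, sub_eq_add_neg]
  simpa only [zero_add, one_mul, add_zero] using hmain.add hrest

theorem hasLeadingTerm_Phi_fox_relator_one_infty :
    HasLeadingTerm (-1) (Phi ρ (fox 0 (relator 1 (M + 2 : ℕ)))) (2 * M + 3)
      (AdRep ρ (word 1) ^ (M + 1) * AdRep ρ fb) := by
  have hw := HasLeadingTerm.Phi_of ρ (-1) (abel_proj_word_two_mul_add_one 0)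
  have hb := HasLeadingTerm.Phi_of ρ (-1) abel_proj_fb
  have hmain := (hw.geom_sum (k := 2) two_ne_zero (M + 1)).mul hb
  have hrest := ((hb.mul (hw.geom_sum (k := 2) two_ne_zero M)).mul hb).neg.weaken
    (d' := 2 * M + 3) one_ne_zero (by push_cast; ring)
  rw [show ((M + 1 : ℕ) * -((2 : ℕ) * -1) + 1 : ℤ) = 2 * M + 3 by push_cast; ring] at hmain
  rw [Phi_fox_relator_one, sub_eq_add_neg]
  simpa only [add_zero] using hmain.add hrest

theorem hasExtremeTerms_one (hρ : IsParabolic ρ) :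
    HasExtremeTerms (adjointAlexander ρ) (3 * (2 * M + 3) - 3) (-1) 3 1 := by
  refine hasExtremeTerms_adjointAlexander hρ
    (hasLeadingTerm_Phi_fox_relator_one_infty ρ) ?_ (neg_ne_zero.2 one_ne_zero)
    (hasLeadingTerm_Phi_fox_relator_one_zero ρ) (det_AdRep ρ fb) one_ne_zero
  rw [Matrix.det_mul, Matrix.det_pow, det_AdRep, det_AdRep, one_pow, mul_one, neg_neg]

end One

end ParabolicExtremeTerms

/-! ### The longitude -/

section Longitude

variable {G : Type*} [Group G] {a b : G} {N : ℕ}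

theorem semiconjBy_inv_mul_pow (a b : G) (m : ℕ) :
    SemiconjBy a ((b⁻¹ * a) ^ m) ((b * a⁻¹) ^ m)⁻¹ := by
  rw [← inv_pow]
  exact SemiconjBy.pow_right (by rw [SemiconjBy]; group) m

theorem semiconjBy_inv_mul_pow_inv (a b : G) (m : ℕ) :
    SemiconjBy b ((b⁻¹ * a) ^ m)⁻¹ ((b * a⁻¹) ^ m) := by
  rw [← inv_pow]
  exact SemiconjBy.pow_right (by rw [SemiconjBy]; group) m

theorem wordIn_two_mul_swap (m : ℕ) (a b : G) :
    wordIn (2 * m) b a = ((b * a⁻¹) ^ m)⁻¹ * ((b⁻¹ * a) ^ m)⁻¹ := by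
  rw [wordIn_two_mul, mul_one, ← inv_pow, ← inv_pow, mul_inv_rev, mul_inv_rev, inv_inv, inv_inv]

theorem wordIn_two_mul_add_one_swap (m : ℕ) (a b : G) :
    wordIn (2 * m + 1) b a = ((b * a⁻¹) ^ m)⁻¹ * (a * b) * ((b⁻¹ * a) ^ m)⁻¹ := by
  rw [wordIn_two_mul_add_one, ← inv_pow, ← inv_pow, mul_inv_rev, mul_inv_rev, inv_inv, inv_inv]

/-- With `c = (ba⁻¹)^m`, the reversed word is `c⁻¹w⁻¹c`, and conjugation by `c`, `w^{-N}`, `c⁻¹`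
takes `b` to `bw⁻¹`, then to `aw⁻¹`, then to `a`. -/
theorem semiconjBy_wordIn_swap_even (m : ℕ) (h : SemiconjBy (wordIn (2 * m) a b ^ N) a b) :
    SemiconjBy (wordIn (2 * m) b a ^ N) b a := by
  have had := semiconjBy_inv_mul_pow a b m
  have hbd := semiconjBy_inv_mul_pow_inv a b m
  have hw := wordIn_two_mul m a b
  rw [mul_one] at hw
  rw [wordIn_two_mul_swap]
  set w := wordIn (2 * m) a b
  set c := (b * a⁻¹) ^ m
  set d := (b⁻¹ * a) ^ m
  have hc : SemiconjBy c b (b * w⁻¹) := by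
    rw [SemiconjBy, ← hbd.eq, hw]
    group
  have hwN : SemiconjBy (w ^ N)⁻¹ (b * w⁻¹) (a * w⁻¹) :=
    h.inv_symm_left.mul_right ((Commute.refl w).pow_left N).inv_inv
  have hc' : SemiconjBy c⁻¹ (a * w⁻¹) a := by
    rw [SemiconjBy, ← mul_assoc, ← had.eq, hw]
    group
  have hswap : c⁻¹ * d⁻¹ = c⁻¹ * w⁻¹ * c⁻¹⁻¹ := by
    rw [hw]
    group
  rw [hswap, conj_pow, inv_inv, inv_pow]
  exact (hc'.mul_left hwN).mul_left hc

/-- With `c = (ba⁻¹)^m`, the reversed word is `(c⁻¹a)w(c⁻¹a)⁻¹`, and conjugation by `(c⁻¹a)⁻¹`,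
`w^N`, `c⁻¹a` takes `b` to `a⁻¹w`, then to `b⁻¹w`, then to `a`. -/
theorem semiconjBy_wordIn_swap_odd (m : ℕ) (h : SemiconjBy (wordIn (2 * m + 1) a b ^ N) a b) :
    SemiconjBy (wordIn (2 * m + 1) b a ^ N) b a := by
  have had := semiconjBy_inv_mul_pow a b m
  have hbd := semiconjBy_inv_mul_pow_inv a b m
  have hca : Commute ((b * a⁻¹) ^ m)⁻¹ (a * b⁻¹) := by
    rw [show a * b⁻¹ = (b * a⁻¹)⁻¹ by group]
    exact ((Commute.refl (b * a⁻¹)).pow_left m).inv_inv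
  have hw := wordIn_two_mul_add_one m a b
  rw [mul_assoc _ (b * a), mul_assoc b, had.eq] at hw
  rw [wordIn_two_mul_add_one_swap, mul_assoc, mul_assoc a, hbd.eq]
  set w := wordIn (2 * m + 1) a b
  set c := (b * a⁻¹) ^ m
  have hc : SemiconjBy (c⁻¹ * a)⁻¹ b (a⁻¹ * w) := by
    rw [SemiconjBy, hw]
    group
  have hwN : SemiconjBy (w ^ N) (a⁻¹ * w) (b⁻¹ * w) :=
    h.inv_right.mul_right ((Commute.refl w).pow_left N)
  have hc' : SemiconjBy (c⁻¹ * a) (b⁻¹ * w) a := by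
    rw [SemiconjBy, ← mul_assoc, mul_assoc c⁻¹, hca.eq, hw]
    group
  have hswap : c⁻¹ * (a * (c * b)) = (c⁻¹ * a) * w * (c⁻¹ * a)⁻¹ := by
    rw [hw]
    group
  rw [hswap, conj_pow]
  exact (hc'.mul_left hwN).mul_left hc

/-- The longitude of `J(k, 2N)` evaluated at two elements of a group. Its last factor is a power
of the meridian that makes it null-homologous. -/
def longitudeIn (k N : ℕ) (a b : G) : G :=
  wordIn k b a ^ N * wordIn k a b ^ N * a⁻¹ ^ (if Even k then 0 else 4 * N)

theorem map_longitudeIn {H : Type*} [Group H] (f : G →* H) (k N : ℕ) (a b : G) :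
    f (longitudeIn k N a b) = longitudeIn k N (f a) (f b) := by
  simp only [longitudeIn, map_mul, map_pow, map_inv, map_wordIn]

theorem commute_longitudeIn {k : ℕ} (h : SemiconjBy (wordIn k a b ^ N) a b) :
    Commute (longitudeIn k N a b) a := by
  have hswap : SemiconjBy (wordIn k b a ^ N) b a := by
    obtain ⟨m, rfl | rfl⟩ := k.even_or_odd'
    · exact semiconjBy_wordIn_swap_even m h
    · exact semiconjBy_wordIn_swap_odd m h
  exact (hswap.mul_left h).mul_left ((Commute.refl a).inv_left.pow_left _)

theorem longitudeIn_self {A : Type*} [CommGroup A] (k N : ℕ) (t : A) : longitudeIn k N t t = 1 := by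
  rw [longitudeIn, wordIn]
  split_ifs
  · simp only [mul_inv_cancel, inv_mul_cancel, one_pow, mul_one, pow_zero]
  · rw [mul_inv_cancel, inv_mul_cancel, one_pow, one_mul, mul_one, inv_pow,
      mul_inv_eq_one, ← pow_add, ← sq, ← pow_mul]
    congr 1
    ring

theorem map_wordIn_of_antihom (f : G →* Gᵐᵒᵖ) (ha : f a = .op a) (hb : f b = .op b) (k : ℕ) :
    f (wordIn k a b) = .op (wordIn k b a) := by
  rw [map_wordIn, ha, hb, wordIn, wordIn]
  split_ifs <;>
    simp only [MulOpposite.op_mul, MulOpposite.op_pow, MulOpposite.op_inv, MulOpposite.op_one,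
      mul_assoc]

end Longitude

/-! ### Parabolic representations over a commutative ring -/

section Riley

open Polynomial (Chebyshev.S)

variable {R S : Type*} [CommRing R] [CommRing S]

/-- Reflection across the anti-diagonal, an anti-automorphism of `SL₂` which fixes the matrices
`[[1, 1], [0, 1]]` and `[[1, 0], [-u, 1]]`. -/
def antiTranspose (R : Type*) [CommRing R] : SL(2, R) →* SL(2, R)ᵐᵒᵖ where
  toFun V := .op ⟨!![V.1 1 1, V.1 0 1; V.1 1 0, V.1 0 0], by
    rw [Matrix.det_fin_two_of]
    linear_combination apply_mul_apply_sub V⟩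
  map_one' := congrArg MulOpposite.op (Subtype.ext (by simp [Matrix.one_fin_two]))
  map_mul' V W := congrArg MulOpposite.op (Subtype.ext (by
    change !![(V.1 * W.1) 1 1, (V.1 * W.1) 0 1; (V.1 * W.1) 1 0, (V.1 * W.1) 0 0] =
      !![W.1 1 1, W.1 0 1; W.1 1 0, W.1 0 0] * !![V.1 1 1, V.1 0 1; V.1 1 0, V.1 0 0]
    simp only [Matrix.mul_apply, Fin.sum_univ_two, Matrix.mul_fin_two, mul_comm, add_comm]))

theorem coe_unop_antiTranspose (V : SL(2, R)) :
    (antiTranspose R V).unop.1 = !![V.1 1 1, V.1 0 1; V.1 1 0, V.1 0 0] := rfl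

/-- The matrix `[[1, 1], [0, 1]]`, the image of the meridian `a`. -/
def parA (R : Type*) [CommRing R] : SL(2, R) := ⟨!![1, 1; 0, 1], by simp⟩

/-- The matrix `[[1, 0], [-u, 1]]`, the image of the meridian `b`. -/
def parB (u : R) : SL(2, R) := ⟨!![1, 0; -u, 1], by simp⟩

/-- The image of the word `w` under `a ↦ parA`, `b ↦ parB u`. -/
def parW (k : ℕ) (u : R) : SL(2, R) := wordIn k (parA R) (parB u)

theorem coe_parA : (parA R).1 = !![1, 1; 0, 1] := rfl

theorem coe_parB (u : R) : (parB u).1 = !![1, 0; -u, 1] := rfl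

theorem coe_inv_parA : ((parA R)⁻¹).1 = !![1, -1; 0, 1] := by
  rw [Matrix.SpecialLinearGroup.coe_inv, coe_parA, Matrix.adjugate_fin_two_of, neg_zero]

theorem coe_inv_parB (u : R) : ((parB u)⁻¹).1 = !![1, 0; u, 1] := by
  rw [Matrix.SpecialLinearGroup.coe_inv, coe_parB, Matrix.adjugate_fin_two_of, neg_zero, neg_neg]

theorem coe_inv_parA_pow (e : ℕ) : ((parA R)⁻¹ ^ e).1 = !![1, -(e : R); 0, 1] := by
  induction e with
  | zero => simp [Matrix.one_fin_two]
  | succ e ih =>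
    rw [pow_succ, Matrix.SpecialLinearGroup.coe_mul, ih, coe_inv_parA]
    simp

theorem map_parA (f : R →+* S) : Matrix.SpecialLinearGroup.map f (parA R) = parA S :=
  Subtype.ext (by
    rw [Matrix.SpecialLinearGroup.map_apply_coe, coe_parA, coe_parA]
    simp [← Matrix.ext_iff, Fin.forall_fin_two])

theorem map_parB (f : R →+* S) (u : R) :
    Matrix.SpecialLinearGroup.map f (parB u) = parB (f u) :=
  Subtype.ext (by
    rw [Matrix.SpecialLinearGroup.map_apply_coe, coe_parB, coe_parB]
    simp [← Matrix.ext_iff, Fin.forall_fin_two])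

theorem map_parW (f : R →+* S) (k : ℕ) (u : R) :
    Matrix.SpecialLinearGroup.map f (parW k u) = parW k (f u) := by
  rw [parW, map_wordIn, map_parA, map_parB, parW]

theorem antiTranspose_parW (k : ℕ) (u : R) :
    antiTranspose R (parW k u) = .op (wordIn k (parB u) (parA R)) :=
  map_wordIn_of_antihom _ rfl rfl k

/-- The value `S_l(2 + u)` of the Chebyshev polynomial at the trace of `ab⁻¹`. -/
def chebTrace (l : ℤ) (u : R) : R := (Chebyshev.S R l).eval (2 + u)

/-- The difference `S_l(2 + u) - S_{l-1}(2 + u)`. -/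
def chebTraceSub (l : ℤ) (u : R) : R := chebTrace l u - chebTrace (l - 1) u

theorem chebTraceSub_sub_one (l : ℤ) (u : R) :
    chebTraceSub (l - 1) u = chebTraceSub l u - u * chebTrace (l - 1) u := by
  have h := eval_chebyshev_S_add_one (l - 1) (2 + u)
  rw [sub_add_cancel] at h
  rw [chebTraceSub, chebTraceSub, chebTrace, chebTrace, chebTrace, h]
  ring

theorem coe_pow_eq_chebTrace {V : SL(2, R)} {p u : R} (hV : V.1 = !![1, p; u * p, 1 + u])
    (m : ℕ) : (V ^ m).1 = !![chebTraceSub (m - 1) u, p * chebTrace (m - 1) u;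
      u * p * chebTrace (m - 1) u, chebTraceSub m u] := by
  have htr : V.1.trace = 2 + u := by
    rw [hV, Matrix.trace_fin_two_of]
    ring
  have hm := chebTraceSub_sub_one (m : ℤ) u
  rw [Matrix.SpecialLinearGroup.coe_pow, pow_eq_chebyshev V.2, htr]
  change chebTrace (m - 1) u • V.1 - chebTrace (m - 2) u • 1 = _
  rw [chebTraceSub, sub_sub, one_add_one_eq_two] at hm ⊢
  have h11 : chebTrace (m - 1) u * (1 + u) - chebTrace (m - 2) u = chebTraceSub m u := by
    linear_combination hm
  rw [hV, Matrix.one_fin_two, ← h11]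
  simp [mul_comm]

theorem coe_parB_mul_inv_parA (u : R) :
    (parB u * (parA R)⁻¹).1 = !![1, -1; u * -1, 1 + u] := by
  rw [Matrix.SpecialLinearGroup.coe_mul, coe_inv_parA, coe_parB, Matrix.mul_fin_two]
  simp [add_comm]

theorem coe_inv_parB_mul_parA (u : R) :
    ((parB u)⁻¹ * parA R).1 = !![1, 1; u * 1, 1 + u] := by
  rw [Matrix.SpecialLinearGroup.coe_mul, coe_inv_parB, coe_parA, Matrix.mul_fin_two]
  simp [add_comm]

theorem chebTraceSub_mul_sub (u : R) (m : ℕ) :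
    chebTraceSub (m - 1) u * chebTraceSub m u - u * chebTrace (m - 1) u ^ 2 = 1 := by
  have h := apply_mul_apply_sub (((parB u)⁻¹ * parA R) ^ m)
  rw [coe_pow_eq_chebTrace (coe_inv_parB_mul_parA u) m] at h
  simp only [Matrix.of_apply, Matrix.cons_val] at h
  linear_combination h

theorem coe_parW_two_mul (m : ℕ) (u : R) : (parW (2 * m) u).1 =
    !![1 - u * chebTrace (m - 1) u * chebTraceSub (m - 1) u, -(u * chebTrace (m - 1) u ^ 2);
      u * (u * chebTrace (m - 1) u ^ 2), chebTraceSub m u ^ 2 - u * chebTrace (m - 1) u ^ 2] := by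
  have hdet := chebTraceSub_mul_sub u m
  have hsub := chebTraceSub_sub_one (m : ℤ) u
  rw [hsub] at hdet
  rw [parW, wordIn_two_mul, mul_one, Matrix.SpecialLinearGroup.coe_mul,
    coe_pow_eq_chebTrace (coe_parB_mul_inv_parA u), coe_pow_eq_chebTrace (coe_inv_parB_mul_parA u),
    Matrix.mul_fin_two, hsub, ← Matrix.ext_iff]
  simp only [Fin.forall_fin_two, Matrix.of_apply, Matrix.cons_val]
  refine ⟨⟨by linear_combination hdet, by ring⟩, by ring, by ring⟩

theorem coe_parW_two_mul_add_one (m : ℕ) (u : R) : (parW (2 * m + 1) u).1 =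
    !![1 + u * chebTraceSub m u * chebTrace (m - 1) u, chebTraceSub m u ^ 2;
      -(u * chebTraceSub m u ^ 2),
      1 - u * chebTraceSub m u ^ 2 - u * chebTraceSub m u * chebTrace (m - 1) u] := by
  have hdet := chebTraceSub_mul_sub u m
  have hsub := chebTraceSub_sub_one (m : ℤ) u
  rw [hsub] at hdet
  rw [parW, wordIn_two_mul_add_one, Matrix.SpecialLinearGroup.coe_mul,
    Matrix.SpecialLinearGroup.coe_mul, Matrix.SpecialLinearGroup.coe_mul,
    coe_pow_eq_chebTrace (coe_parB_mul_inv_parA u), coe_pow_eq_chebTrace (coe_inv_parB_mul_parA u),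
    coe_parA, coe_parB, Matrix.mul_fin_two, Matrix.mul_fin_two, Matrix.mul_fin_two,
    hsub, ← Matrix.ext_iff]
  simp only [Fin.forall_fin_two, Matrix.of_apply, Matrix.cons_val]
  refine ⟨⟨by linear_combination hdet, by ring⟩, by ring, by linear_combination hdet⟩

theorem parW_one_zero (k : ℕ) (u : R) : (parW k u).1 1 0 = -(u * (parW k u).1 0 1) := by
  obtain ⟨m, rfl | rfl⟩ := k.even_or_odd'
  · simp [coe_parW_two_mul]
  · simp [coe_parW_two_mul_add_one]

theorem trace_parW (k : ℕ) (u : R) : (parW k u).1.trace = 2 - u * (parW k u).1 0 1 := by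
  obtain ⟨m, rfl | rfl⟩ := k.even_or_odd'
  · rw [coe_parW_two_mul, Matrix.trace_fin_two_of]
    simp only [Matrix.of_apply, Matrix.cons_val]
    have hdet := chebTraceSub_mul_sub u m
    have hsub := chebTraceSub_sub_one (m : ℤ) u
    rw [hsub] at hdet ⊢
    linear_combination hdet
  · rw [coe_parW_two_mul_add_one, Matrix.trace_fin_two_of]
    simp only [Matrix.of_apply, Matrix.cons_val]
    ring

/-- The Riley polynomial of `J(k, 2N)` at `u`, that is, the upper left entry of `parW k u ^ N`.
Its roots are the parameters for which `a ↦ parA`, `b ↦ parB u` is a representation. -/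
def riley (k N : ℕ) (u : R) : R := (parW k u ^ N).1 0 0

theorem map_riley (f : R →+* S) (k N : ℕ) (u : R) : f (riley k N u) = riley k N (f u) := by
  rw [riley, riley, ← map_parW, ← map_pow]
  rfl

theorem parW_pow_apply (k N : ℕ) (u : R) (i j : Fin 2) : (parW k u ^ N).1 i j =
    (Chebyshev.S R (N - 1)).eval (parW k u).1.trace * (parW k u).1 i j -
      (Chebyshev.S R (N - 2)).eval (parW k u).1.trace * (1 : Matrix _ _ R) i j := by
  rw [Matrix.SpecialLinearGroup.coe_pow, pow_eq_chebyshev (parW k u).2]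
  rfl

theorem coe_parW_pow {k N : ℕ} {u : R} (h : riley k N u = 0) : ∃ q s : R,
    (parW k u ^ N).1 = !![0, q; -(u * q), s] ∧ u * q ^ 2 = 1 ∧ ∃ c : R, q * s = 2 * c - 1 := by
  set V := parW k u
  set σ := (Chebyshev.S R (N - 1)).eval V.1.trace
  set τ := (Chebyshev.S R (N - 2)).eval V.1.trace
  have hentry : ∀ i j, (V ^ N).1 i j = σ * V.1 i j - τ * (1 : Matrix _ _ R) i j :=
    parW_pow_apply k N u
  have h00 : σ * V.1 0 0 - τ = 0 := by
    rw [← h, riley, hentry, Matrix.one_apply_eq, mul_one]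
  have h01 : (V ^ N).1 0 1 = σ * V.1 0 1 := by
    rw [hentry, Matrix.one_apply_ne zero_ne_one, mul_zero, sub_zero]
  have h10 : (V ^ N).1 1 0 = -(u * (V ^ N).1 0 1) := by
    rw [h01, hentry, Matrix.one_apply_ne one_ne_zero, parW_one_zero]
    ring
  have hdet := apply_mul_apply_sub (V ^ N)
  have h0 : (V ^ N).1 0 0 = 0 := h
  rw [h0, h10] at hdet
  have htr := trace_parW k u
  rw [Matrix.trace_fin_two] at htr
  have hu : u * (V ^ N).1 0 1 ^ 2 = 1 := by linear_combination hdet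
  refine ⟨(V ^ N).1 0 1, (V ^ N).1 1 1, ?_, hu, (V ^ N).1 0 1 * (σ - τ), ?_⟩
  · rw [← h10, ← h0]
    exact Matrix.eta_fin_two _
  · rw [hentry 1 1, Matrix.one_apply_eq, mul_one]
    linear_combination (V ^ N).1 0 1 * σ * htr - (V ^ N).1 0 1 * h00 - hu
      + u * (V ^ N).1 0 1 * h01

theorem semiconjBy_parW_pow {k N : ℕ} {u : R} (h : riley k N u = 0) :
    SemiconjBy (parW k u ^ N) (parA R) (parB u) := by
  obtain ⟨q, s, hV, -, -⟩ := coe_parW_pow h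
  refine Subtype.ext ?_
  rw [Matrix.SpecialLinearGroup.coe_mul, Matrix.SpecialLinearGroup.coe_mul, hV, coe_parA, coe_parB]
  simp

/-- In terms of the anti-diagonal reflection, the longitude is the product of the reflected
`w^N = [[0, q], [-uq, s]]`, of `w^N`, and of a power of the meridian. -/
theorem coe_longitudeIn {k N : ℕ} {u : R} (h : riley k N u = 0) :
    ∃ c : R, (longitudeIn k N (parA R) (parB u)).1 = !![-1, 2 * (2 * c - 1); 0, -1] := by
  obtain ⟨q, s, hV, hu, c, hc⟩ := coe_parW_pow h
  have hswap : wordIn k (parB u) (parA R) ^ N = (antiTranspose R (parW k u ^ N)).unop := by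
    rw [map_pow, antiTranspose_parW, ← MulOpposite.op_pow, MulOpposite.unop_op]
  set e := if Even k then 0 else 4 * N with he
  obtain ⟨d, hd⟩ : ∃ d, e = 4 * d := by
    rw [he]
    split_ifs
    exacts [⟨0, rfl⟩, ⟨N, rfl⟩]
  refine ⟨c + d, ?_⟩
  rw [longitudeIn, hswap, ← parW, ← he, Matrix.SpecialLinearGroup.coe_mul,
    Matrix.SpecialLinearGroup.coe_mul, coe_unop_antiTranspose, hV, coe_inv_parA_pow, hd,
    Matrix.mul_fin_two, Matrix.mul_fin_two, ← Matrix.ext_iff]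
  simp only [Fin.forall_fin_two, Matrix.of_apply, Matrix.cons_val]
  push_cast
  refine ⟨⟨by linear_combination -hu, by linear_combination 4 * d * hu + 2 * hc⟩, by ring,
    by linear_combination -hu⟩

theorem neg_one_unipotent_pow (κ : R) (j : ℕ) :
    !![-1, κ; 0, -1] ^ j = (-1 : R) ^ j • !![1, -(j * κ); 0, 1] := by
  induction j with
  | zero => simp [Matrix.one_fin_two]
  | succ j ih =>
    rw [pow_succ, ih, Matrix.smul_mul, Matrix.mul_fin_two, pow_succ, mul_smul]
    simp
    ring

/-- The off-diagonal entry of the longitude is `2` times an odd element. -/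
theorem longitudeIn_pow_ne_one [IsDomain R] [CharZero R] (h2 : ¬ IsUnit (2 : R)) {k N : ℕ} {u : R}
    (h : riley k N u = 0) {j : ℕ} (hj : j ≠ 0) :
    longitudeIn k N (parA R) (parB u) ^ j ≠ 1 := by
  intro hone
  obtain ⟨c, hc⟩ := coe_longitudeIn h
  have h01 : (longitudeIn k N (parA R) (parB u) ^ j).1 0 1 = 0 := by
    rw [hone]
    rfl
  rw [Matrix.SpecialLinearGroup.coe_pow, hc, neg_one_unipotent_pow] at h01
  have h_odd : 2 * c - 1 = 0 := by simpa [hj] using h01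
  exact h2 (IsUnit.of_mul_eq_one c (sub_eq_zero.1 h_odd))

end Riley

/-! ### Existence of a parabolic representation over the algebraic integers -/

section Integral

open Polynomial

variable {R : Type*} [CommRing R]

/-- `p` is nonconstant and its leading coefficient is a unit, so that `p` has roots and they are
all integral. -/
def NonconstUnitLeading (p : R[X]) : Prop := 0 < p.degree ∧ IsUnit p.leadingCoeff

theorem NonconstUnitLeading.sub_of_degree_lt {p q : R[X]} (hp : NonconstUnitLeading p)
    (h : q.degree < p.degree) : NonconstUnitLeading (p - q) :=
  ⟨(degree_sub_eq_left_of_degree_lt h).symm ▸ hp.1,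
    (leadingCoeff_sub_of_degree_lt h).symm ▸ hp.2⟩

theorem NonconstUnitLeading.sub_of_degree_le_zero {p q : R[X]} (hp : NonconstUnitLeading p)
    (h : q.degree ≤ 0) : NonconstUnitLeading (p - q) :=
  hp.sub_of_degree_lt (h.trans_lt hp.1)

theorem NonconstUnitLeading.neg {p : R[X]} (hp : NonconstUnitLeading p) :
    NonconstUnitLeading (-p) :=
  ⟨p.degree_neg.symm ▸ hp.1, p.leadingCoeff_neg.symm ▸ hp.2.neg⟩

variable [IsDomain R]

theorem zero_le_degree_of_isUnit_leadingCoeff {p : R[X]} (hp : IsUnit p.leadingCoeff) :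
    0 ≤ p.degree :=
  zero_le_degree_iff.2 (leadingCoeff_ne_zero.1 hp.ne_zero)

theorem NonconstUnitLeading.mul {p q : R[X]} (hp : NonconstUnitLeading p)
    (hq : IsUnit q.leadingCoeff) : NonconstUnitLeading (p * q) := by
  refine ⟨?_, by rw [leadingCoeff_mul]; exact hp.2.mul hq⟩
  rw [degree_mul]
  exact add_pos_of_pos_of_nonneg hp.1 (zero_le_degree_of_isUnit_leadingCoeff hq)

theorem NonconstUnitLeading.degree_lt_degree_mul {p q : R[X]} (hp : NonconstUnitLeading p)
    (hq : IsUnit q.leadingCoeff) : q.degree < (p * q).degree := by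
  rw [degree_mul]
  have hq0 : q ≠ 0 := leadingCoeff_ne_zero.1 hq.ne_zero
  rw [degree_eq_natDegree hq0]
  have := hp.1
  rw [degree_eq_natDegree (leadingCoeff_ne_zero.1 hp.2.ne_zero)] at this ⊢
  norm_cast at this ⊢
  omega

theorem NonconstUnitLeading.chebyshev {v : R[X]} (hv : NonconstUnitLeading v) (n : ℕ) :
    ((Chebyshev.S R[X] (n - 1)).eval v).degree < ((Chebyshev.S R[X] n).eval v).degree ∧
      IsUnit ((Chebyshev.S R[X] n).eval v).leadingCoeff := by
  induction n with
  | zero => simp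
  | succ n ih =>
    have hmul := hv.degree_lt_degree_mul ih.2
    have hlt := ih.1.trans hmul
    rw [Nat.cast_succ, add_sub_cancel_right, eval_chebyshev_S_add_one,
      degree_sub_eq_left_of_degree_lt hlt, leadingCoeff_sub_of_degree_lt hlt]
    exact ⟨hmul, (hv.mul ih.2).2⟩

theorem nonconstUnitLeading_X : NonconstUnitLeading (X : R[X]) := by
  rw [NonconstUnitLeading, degree_X, leadingCoeff_X]
  exact ⟨one_pos, isUnit_one⟩

theorem nonconstUnitLeading_two_add_X : NonconstUnitLeading (2 + X : R[X]) := by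
  have h := (nonconstUnitLeading_X (R := R)).sub_of_degree_le_zero
    (q := -2) (by rw [degree_neg]; exact degree_natCast_le 2)
  rwa [sub_neg_eq_add, add_comm] at h

theorem isUnit_leadingCoeff_chebTrace (m : ℕ) :
    IsUnit (chebTrace m (X : R[X])).leadingCoeff :=
  (nonconstUnitLeading_two_add_X.chebyshev m).2

theorem isUnit_leadingCoeff_chebTraceSub (m : ℕ) :
    IsUnit (chebTraceSub m (X : R[X])).leadingCoeff := by
  have h := nonconstUnitLeading_two_add_X.chebyshev (R := R) m
  rw [chebTraceSub, chebTrace, chebTrace, leadingCoeff_sub_of_degree_lt h.1]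
  exact h.2

theorem nonconstUnitLeading_parW_zero_zero {k : ℕ} (hk : 2 ≤ k) :
    NonconstUnitLeading ((parW k (X : R[X])).1 0 0) := by
  obtain ⟨m, rfl | rfl⟩ := k.even_or_odd'
  all_goals obtain ⟨m, rfl⟩ := Nat.exists_eq_succ_of_ne_zero (show m ≠ 0 by omega)
  · have h := ((nonconstUnitLeading_X.mul (isUnit_leadingCoeff_chebTrace m)).mul
      (isUnit_leadingCoeff_chebTraceSub (R := R) m)).sub_of_degree_le_zero degree_one_le
    simpa [coe_parW_two_mul] using h.neg
  · have h := ((nonconstUnitLeading_X.mul (isUnit_leadingCoeff_chebTraceSub (m + 1))).mul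
      (isUnit_leadingCoeff_chebTrace (R := R) m)).neg.sub_of_degree_le_zero degree_one_le
    simpa [coe_parW_two_mul_add_one, add_comm (1 : R[X])] using h.neg

theorem nonconstUnitLeading_parW_trace {k : ℕ} (hk : k ≠ 0) :
    NonconstUnitLeading (parW k (X : R[X])).1.trace := by
  have htwo : (2 : R[X]).degree ≤ 0 := degree_natCast_le 2
  rw [trace_parW]
  suffices h : IsUnit ((parW k (X : R[X])).1 0 1).leadingCoeff by
    simpa using ((nonconstUnitLeading_X.mul h).sub_of_degree_le_zero htwo).neg
  obtain ⟨m, rfl | rfl⟩ := k.even_or_odd'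
  · obtain ⟨m, rfl⟩ := Nat.exists_eq_succ_of_ne_zero (show m ≠ 0 by omega)
    simpa [coe_parW_two_mul] using isUnit_leadingCoeff_chebTrace (R := R) m
  · simpa [coe_parW_two_mul_add_one] using isUnit_leadingCoeff_chebTraceSub (R := R) m

theorem nonconstUnitLeading_riley {k N : ℕ} (h : 2 ≤ k ∧ N ≠ 0 ∨ k = 1 ∧ 2 ≤ N) :
    NonconstUnitLeading (riley k N (X : R[X])) := by
  obtain ⟨N, rfl⟩ := Nat.exists_eq_succ_of_ne_zero (show N ≠ 0 by omega)
  have hS := (nonconstUnitLeading_parW_trace (R := R) (show k ≠ 0 by omega)).chebyshev N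
  rw [riley, parW_pow_apply, Matrix.one_apply_eq, mul_one, Nat.cast_succ, add_sub_cancel_right,
    add_sub_assoc, show (1 : ℤ) - 2 = -1 by norm_num, ← sub_eq_add_neg]
  rcases h with ⟨hk, -⟩ | ⟨rfl, hN⟩
  · have hV := nonconstUnitLeading_parW_zero_zero (R := R) hk
    rw [mul_comm]
    exact (hV.mul hS.2).sub_of_degree_lt (hS.1.trans (hV.degree_lt_degree_mul hS.2))
  · obtain ⟨N, rfl⟩ := Nat.exists_eq_succ_of_ne_zero (show N ≠ 0 by omega)
    have h00 : (parW 1 (X : R[X])).1 0 0 = 1 := by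
      simpa [chebTrace] using congrFun₂ (coe_parW_two_mul_add_one 0 (X : R[X])) 0 0
    have hN := (nonconstUnitLeading_parW_trace (R := R) one_ne_zero).chebyshev N
    rw [h00, mul_one]
    refine NonconstUnitLeading.sub_of_degree_lt ⟨?_, hS.2⟩ hS.1
    refine (zero_le_degree_of_isUnit_leadingCoeff hN.2).trans_lt ?_
    simpa using hS.1

theorem exists_isIntegral_root {p : ℤ[X]} (hp : NonconstUnitLeading p) :
    ∃ u : integralClosure ℤ ℂ, aeval u p = 0 := by
  obtain ⟨x, hx⟩ := IsAlgClosed.exists_aeval_eq_zero ℂ p hp.1.ne'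
  have hint : IsIntegral ℤ x := by
    obtain ⟨c, hc⟩ := hp.2.exists_left_inv
    have h := (isIntegral_leadingCoeff_smul p x hx).smul c
    rwa [smul_smul, hc, one_smul] at h
  exact ⟨⟨x, hint⟩, (aeval_algebraMap_eq_zero_iff_of_injective
    (A := integralClosure ℤ ℂ) (B := ℂ) Subtype.val_injective).1 hx⟩

theorem not_isUnit_two_integralClosure : ¬ IsUnit (2 : integralClosure ℤ ℂ) := by
  intro h
  rw [← map_ofNat (algebraMap ℤ (integralClosure ℤ ℂ)) 2] at h
  exact Int.prime_two.not_isUnit (isUnit_of_map_unit _ _ h)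

theorem exists_riley_eq_zero {k N : ℕ} (h : 2 ≤ k ∧ N ≠ 0 ∨ k = 1 ∧ 2 ≤ N) :
    ∃ u : integralClosure ℤ ℂ, riley k N u = 0 := by
  obtain ⟨u, hu⟩ := exists_isIntegral_root (nonconstUnitLeading_riley h)
  refine ⟨u, ?_⟩
  rwa [← RingHom.coe_coe, map_riley, RingHom.coe_coe, aeval_X] at hu

end Integral

section Longitude

/-- The longitude of `J(k, 2N)`. -/
def longitude (k N : ℕ) : KnotGroup k N := longitudeIn k N (proj k N fa) (proj k N fb)

theorem commute_longitude (k N : ℕ) : Commute (longitude k N) (proj k N fa) := by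
  refine commute_longitudeIn ?_
  rw [← map_wordIn, ← word_eq_wordIn, ← zpow_natCast]
  exact semiconjBy_proj_word

theorem abel_longitude (k N : ℕ) : abel k N (longitude k N) = 1 := by
  rw [longitude, map_longitudeIn, abel_proj_fa, abel_proj_fb, longitudeIn_self]

theorem exists_hom_of_riley_eq_zero {R : Type*} [CommRing R] {k N : ℕ} {u : R}
    (h : riley k N u = 0) :
    ∃ φ : KnotGroup k N →* SL(2, R), φ (proj k N fa) = parA R ∧ φ (proj k N fb) = parB u := by
  let f := FreeGroup.lift ![parA R, parB u]
  have ha : f fa = parA R := FreeGroup.lift_apply_of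
  have hb : f fb = parB u := FreeGroup.lift_apply_of
  have hrel : ∀ r ∈ ({relator k N} : Set F2), f r = 1 := by
    rintro _ rfl
    rw [relator, zpow_neg, zpow_natCast, map_mul, map_mul, map_mul, map_inv, map_inv, map_pow,
      word_eq_wordIn, map_wordIn, ha, hb, mul_inv_eq_one, mul_inv_eq_iff_eq_mul]
    exact semiconjBy_parW_pow h
  exact ⟨PresentedGroup.toGroup hrel, PresentedGroup.toGroup.of hrel,
    PresentedGroup.toGroup.of hrel⟩

theorem longitude_pow_ne_one {k N : ℕ} (h : 2 ≤ k ∧ N ≠ 0 ∨ k = 1 ∧ 2 ≤ N) {j : ℕ} (hj : j ≠ 0) :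
    longitude k N ^ j ≠ 1 := by
  obtain ⟨u, hu⟩ := exists_riley_eq_zero h
  obtain ⟨φ, ha, hb⟩ := exists_hom_of_riley_eq_zero hu
  intro hone
  apply longitudeIn_pow_ne_one not_isUnit_two_integralClosure hu hj
  rw [← ha, ← hb, ← map_longitudeIn, ← longitude, ← map_pow, hone, map_one]

end Longitude

/-! ### Meridians of holonomy lifts are parabolic -/

section Discrete

open Filter Topology

theorem exists_lt_mul_inv_mem (x : ℕ → ℂˣ) {r R : ℝ} (hr : 0 < r)
    (hx : ∀ k, r ≤ ‖(x k : ℂ)‖ ∧ ‖(x k : ℂ)‖ ≤ R) {V : Set ℂˣ} (hV : V ∈ 𝓝 1) :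
    ∃ k l : ℕ, k < l ∧ x l * (x k)⁻¹ ∈ V := by
  obtain ⟨O, hO, hOV⟩ : ∃ O ∈ 𝓝 (1 : ℂ), Units.val ⁻¹' O ⊆ V := by
    rwa [Units.isEmbedding_val₀.nhds_eq_comap] at hV
  obtain ⟨y, -, φ, hφ, hlim⟩ := tendsto_subseq_of_bounded (s := Metric.closedBall (0 : ℂ) R)
    Metric.isBounded_closedBall (x := fun k => (x k : ℂ))
    (fun k => mem_closedBall_zero_iff.2 (hx k).2)
  have hy : y ≠ 0 :=
    norm_pos_iff.1 (hr.trans_le (ge_of_tendsto hlim.norm (.of_forall fun k => (hx (φ k)).1)))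
  have hratio : Tendsto (fun k => (x (φ (k + 1)) : ℂ) * ((x (φ k) : ℂ))⁻¹) atTop (𝓝 1) := by
    rw [← mul_inv_cancel₀ hy]
    exact (hlim.comp (tendsto_add_atTop_nat 1)).mul (hlim.inv₀ hy)
  obtain ⟨k, hk⟩ := (hratio.eventually_mem hO).exists
  exact ⟨φ k, φ (k + 1), hφ k.lt_succ_self, hOV (by simpa using hk)⟩

theorem norm_zpow_mul_pow (μ ν : ℂˣ) (i : ℤ) (k : ℕ) : ‖((μ ^ i * ν ^ k : ℂˣ) : ℂ)‖ =
    Real.exp (i * Real.log ‖(μ : ℂ)‖ + k * Real.log ‖(ν : ℂ)‖) := by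
  have hμ : 0 < ‖(μ : ℂ)‖ := norm_pos_iff.2 μ.ne_zero
  have hν : 0 < ‖(ν : ℂ)‖ := norm_pos_iff.2 ν.ne_zero
  rw [Units.val_mul, norm_mul, Units.val_zpow_eq_zpow_val, norm_zpow, Units.val_pow_eq_pow_val,
    norm_pow, Real.exp_add, mul_comm (i : ℝ), Real.exp_mul, Real.rpow_intCast, Real.exp_nat_mul,
    Real.exp_log hμ, Real.exp_log hν]

theorem exists_abs_intCast_mul_add_le {α : ℝ} (hα : α ≠ 0) (β : ℝ) :
    ∃ i : ℤ, |i * α + β| ≤ |α| := by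
  refine ⟨-⌊β / α⌋, ?_⟩
  have h : ((-⌊β / α⌋ : ℤ) : ℝ) * α + β = Int.fract (β / α) * α := by
    rw [Int.fract, sub_mul, div_mul_cancel₀ _ hα]
    push_cast
    ring
  rw [h, abs_mul, abs_of_nonneg (Int.fract_nonneg _)]
  exact mul_le_of_le_one_left (abs_nonneg _) (Int.fract_lt_one _).le

theorem exists_zpow_mul_zpow_mem (μ ν : ℂˣ) {V : Set ℂˣ} (hV : V ∈ 𝓝 1) :
    ∃ i j : ℤ, (i ≠ 0 ∨ j ≠ 0) ∧ μ ^ i * ν ^ j ∈ V := by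
  by_cases hα : Real.log ‖(μ : ℂ)‖ = 0
  · have hnorm : ‖(μ : ℂ)‖ = 1 := Real.eq_one_of_pos_of_log_eq_zero (norm_pos_iff.2 μ.ne_zero) hα
    obtain ⟨k, l, hkl, h⟩ := exists_lt_mul_inv_mem (fun k => μ ^ k) one_pos (R := 1)
      (fun k => by simp [hnorm]) hV
    refine ⟨(l : ℤ) - k, 0, Or.inl (by omega), ?_⟩
    rwa [zpow_zero, mul_one, zpow_sub, zpow_natCast, zpow_natCast]
  · choose i hi using fun k : ℕ => exists_abs_intCast_mul_add_le hα (k * Real.log ‖(ν : ℂ)‖)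
    obtain ⟨k, l, hkl, h⟩ := exists_lt_mul_inv_mem (fun k => μ ^ i k * ν ^ k)
      (Real.exp_pos _) (fun k => by
        rw [norm_zpow_mul_pow, Real.exp_le_exp, Real.exp_le_exp]
        exact abs_le.1 (hi k)) hV
    refine ⟨i l - i k, (l : ℤ) - k, Or.inr (by omega), ?_⟩
    rwa [zpow_sub, zpow_sub, zpow_natCast, zpow_natCast, mul_mul_mul_comm, ← mul_inv]

/-- The diagonal matrix in `SL₂(ℂ)` with entries `x` and `x⁻¹`. -/
def diagSL : ℂˣ →* SL(2, ℂ) where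
  toFun x := ⟨!![(x : ℂ), 0; 0, ((x⁻¹ : ℂˣ) : ℂ)], by simp [Matrix.det_fin_two]⟩
  map_one' := Subtype.ext (by simp [Matrix.one_fin_two])
  map_mul' x y := Subtype.ext (by
    change !![((x * y : ℂˣ) : ℂ), 0; 0, (((x * y)⁻¹ : ℂˣ) : ℂ)] =
      !![(x : ℂ), 0; 0, ((x⁻¹ : ℂˣ) : ℂ)] * !![(y : ℂ), 0; 0, ((y⁻¹ : ℂˣ) : ℂ)]
    simp [mul_comm])

theorem coe_diagSL (x : ℂˣ) : (diagSL x).1 = !![(x : ℂ), 0; 0, ((x⁻¹ : ℂˣ) : ℂ)] := rfl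

theorem continuous_diagSL : Continuous diagSL := by
  refine Continuous.subtype_mk (continuous_matrix fun i j => ?_) _
  fin_cases i <;> fin_cases j
  exacts [Units.continuous_val, continuous_const, continuous_const,
    Units.continuous_val.comp continuous_inv]

theorem exists_eq_diagSL {V : SL(2, ℂ)} (h01 : V.1 0 1 = 0) (h10 : V.1 1 0 = 0) :
    ∃ x : ℂˣ, V = diagSL x := by
  have hdet : V.1 0 0 * V.1 1 1 = 1 := by
    linear_combination apply_mul_apply_sub V + V.1 1 0 * h01
  refine ⟨Units.mk0 (V.1 0 0) (left_ne_zero_of_mul_eq_one hdet), Subtype.ext ?_⟩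
  conv_lhs => rw [Matrix.eta_fin_two V.1, h01, h10, eq_inv_of_mul_eq_one_right hdet]
  simp [coe_diagSL]

theorem exists_eq_conj_diagSL {V : SL(2, ℂ)} (hV : V.1.trace ^ 2 ≠ 4) :
    ∃ (P : SL(2, ℂ)) (x : ℂˣ), V = P * diagSL x * P⁻¹ ∧ (x : ℂ) ≠ ((x⁻¹ : ℂˣ) : ℂ) := by
  obtain ⟨P, T, rfl, hT⟩ := exists_eq_conj_triangular V
  have hdet := apply_mul_apply_sub T
  rw [hT, mul_zero, sub_zero] at hdet
  have hne : T.1 0 0 - T.1 1 1 ≠ 0 := by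
    intro h
    apply hV
    rw [trace_conj, Matrix.trace_fin_two]
    linear_combination (T.1 0 0 - T.1 1 1) * h + 4 * hdet
  let U : SL(2, ℂ) := ⟨!![1, -(T.1 0 1 / (T.1 0 0 - T.1 1 1)); 0, 1], by simp⟩
  have hUT : (U⁻¹ * T * U).1 = !![T.1 0 0, 0; 0, T.1 1 1] := by
    rw [Matrix.SpecialLinearGroup.coe_mul, Matrix.SpecialLinearGroup.coe_mul,
      Matrix.SpecialLinearGroup.coe_inv, Matrix.adjugate_fin_two_of, Matrix.eta_fin_two T.1, hT,
      Matrix.mul_fin_two, Matrix.mul_fin_two]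
    simp
    field_simp
    ring
  obtain ⟨x, hx⟩ := exists_eq_diagSL (V := U⁻¹ * T * U) (by rw [hUT]; rfl) (by rw [hUT]; rfl)
  refine ⟨P * U, x, by rw [← hx]; group, ?_⟩
  rw [hx, coe_diagSL] at hUT
  have hx0 : (x : ℂ) = T.1 0 0 := congrFun₂ hUT 0 0
  have hx1 : ((x⁻¹ : ℂˣ) : ℂ) = T.1 1 1 := congrFun₂ hUT 1 1
  rw [hx0, hx1]
  exact sub_ne_zero.1 hne

theorem exists_eq_diagSL_of_commute {x : ℂˣ} (hx : (x : ℂ) ≠ ((x⁻¹ : ℂˣ) : ℂ)) {V : SL(2, ℂ)}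
    (h : Commute V (diagSL x)) : ∃ y : ℂˣ, V = diagSL y := by
  have hcoe := congrArg Subtype.val h.eq
  rw [Matrix.SpecialLinearGroup.coe_mul, Matrix.SpecialLinearGroup.coe_mul, coe_diagSL] at hcoe
  have h01 := congrFun₂ hcoe 0 1
  have h10 := congrFun₂ hcoe 1 0
  simp only [Matrix.mul_apply, Fin.sum_univ_two, Matrix.of_apply, Matrix.cons_val, mul_zero,
    zero_mul, zero_add, add_zero] at h01 h10
  refine exists_eq_diagSL ?_ ?_
  · have : V.1 0 1 * (((x⁻¹ : ℂˣ) : ℂ) - x) = 0 := by linear_combination h01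
    exact (mul_eq_zero.1 this).resolve_right (sub_ne_zero.2 hx.symm)
  · have : V.1 1 0 * ((x : ℂ) - ((x⁻¹ : ℂˣ) : ℂ)) = 0 := by linear_combination h10
    exact (mul_eq_zero.1 this).resolve_right (sub_ne_zero.2 hx)

theorem exists_eq_conj_diagSL_of_commute {V W : SL(2, ℂ)} (hV : V.1.trace ^ 2 ≠ 4)
    (h : Commute W V) :
    ∃ (P : SL(2, ℂ)) (μ ν : ℂˣ), V = P * diagSL μ * P⁻¹ ∧ W = P * diagSL ν * P⁻¹ := by
  obtain ⟨P, μ, rfl, hne⟩ := exists_eq_conj_diagSL hV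
  have hconj : Commute (P⁻¹ * W * P) (diagSL μ) := by
    simpa [mul_assoc] using h.map (MulAut.conj P⁻¹).toMonoidHom
  obtain ⟨ν, hν⟩ := exists_eq_diagSL_of_commute hne hconj
  exact ⟨P, μ, ν, rfl, by rw [← hν]; group⟩

section Holonomy

variable {G : Type} [Group G] {ρ : G →* SL(2, ℂ)}

theorem IsHolonomyLift.exists_nhds (h : IsHolonomyLift ρ) :
    ∃ U ∈ 𝓝 (1 : SL(2, ℂ)), ∀ g, ρ g ∈ U → g = 1 := by
  obtain ⟨hinj, hdisc⟩ := h
  obtain ⟨O, hO, hO1⟩ := isOpen_induced_iff.1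
    (isOpen_discrete ({1} : Set (toPSL.comp ρ).range))
  have hcont : Continuous toPSL := continuous_quotient_mk'
  refine ⟨toPSL ⁻¹' O, (hO.preimage hcont).mem_nhds ?_, fun g hg => ?_⟩
  · have hone : (1 : (toPSL.comp ρ).range) ∈ Subtype.val ⁻¹' O := hO1.ge rfl
    rwa [Set.mem_preimage, map_one]
  · have hmem : (⟨toPSL (ρ g), ⟨g, rfl⟩⟩ : (toPSL.comp ρ).range) ∈ Subtype.val ⁻¹' O := hg
    rw [hO1, Set.mem_singleton_iff] at hmem
    exact (injective_iff_map_eq_one _).1 hinj g (congrArg Subtype.val hmem)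

theorem IsHolonomyLift.exists_zpow_mul_zpow_eq_one (h : IsHolonomyLift ρ) {a l : G}
    (hcomm : Commute l a) (ha : (ρ a).1.trace ^ 2 ≠ 4) :
    ∃ i j : ℤ, (i ≠ 0 ∨ j ≠ 0) ∧ a ^ i * l ^ j = 1 := by
  obtain ⟨U, hU, hU1⟩ := h.exists_nhds
  obtain ⟨P, μ, ν, hμ, hν⟩ := exists_eq_conj_diagSL_of_commute ha (hcomm.map ρ)
  have hcont : Continuous fun x : ℂˣ => P * diagSL x * P⁻¹ :=
    (continuous_const.mul continuous_diagSL).mul continuous_const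
  have hV : (fun x : ℂˣ => P * diagSL x * P⁻¹) ⁻¹' U ∈ 𝓝 1 := by
    refine hcont.continuousAt.preimage_mem_nhds ?_
    rwa [map_one, mul_one, mul_inv_cancel]
  obtain ⟨i, j, hij, hmem⟩ := exists_zpow_mul_zpow_mem μ ν hV
  refine ⟨i, j, hij, hU1 _ ?_⟩
  rw [map_mul, map_zpow, map_zpow, hμ, hν, conj_zpow, conj_zpow, conj_mul, ← map_zpow, ← map_zpow,
    ← map_mul]
  exact hmem

theorem IsHolonomyLift.trace_sq_eq_four (h : IsHolonomyLift ρ) {a l : G} (hcomm : Commute l a)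
    (d : G →* Multiplicative ℤ) (hda : d a = Multiplicative.ofAdd 1) (hdl : d l = 1)
    (hl : ∀ j : ℕ, j ≠ 0 → l ^ j ≠ 1) : (ρ a).1.trace ^ 2 = 4 := by
  by_contra htr
  obtain ⟨i, j, hij, hrel⟩ := h.exists_zpow_mul_zpow_eq_one hcomm htr
  have hi : i = 0 := by simpa [hda, hdl] using congrArg (fun g => (d g).toAdd) hrel
  rw [hi, zpow_zero, one_mul] at hrel
  refine hl j.natAbs (Int.natAbs_ne_zero.2 (hij.resolve_left (not_not.2 hi))) ?_
  rwa [pow_natAbs_eq_one]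

end Holonomy

variable {k N : ℕ} {ρ : KnotGroup k N →* SL(2, ℂ)}

/-- If the group were abelian, it would be generated by the meridian `a`, and the longitude, having
exponent sum zero, would be trivial. -/
theorem exists_not_commute (h : 2 ≤ k ∧ N ≠ 0 ∨ k = 1 ∧ 2 ≤ N) :
    ∃ x y : KnotGroup k N, x * y ≠ y * x := by
  by_contra! hcomm
  have hba : proj k N fb = proj k N fa := by
    have hw := (semiconjBy_proj_word (k := k) (n := N)).eq
    rw [hcomm] at hw
    exact (mul_right_cancel hw).symm
  have hfa := Subgroup.mem_zpowers (proj k N fa)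
  obtain ⟨i, hi⟩ := map_mem_of_map_generators_mem (.id _) hfa (hba ▸ hfa) (longitude k N)
  change proj k N fa ^ i = longitude k N at hi
  have h0 : i = 0 := by
    simpa [abel_proj_fa, abel_longitude] using congrArg (fun g => (abel k N g).toAdd) hi
  rw [h0, zpow_zero] at hi
  exact longitude_pow_ne_one h one_ne_zero (by rw [← hi, one_pow])

theorem IsHolonomyLift.isNonabelian {G : Type} [Group G] {ρ : G →* SL(2, ℂ)}
    (h : IsHolonomyLift ρ) (hG : ∃ x y : G, x * y ≠ y * x) : IsNonabelian ρ := by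
  have hinj : Function.Injective ρ := .of_comp (f := toPSL) h.1
  obtain ⟨x, y, hxy⟩ := hG
  exact ⟨x, y, fun he => hxy (hinj (by rw [map_mul, map_mul, he]))⟩

theorem isParabolic_of_isHolonomyLift_or (h : 2 ≤ k ∧ N ≠ 0 ∨ k = 1 ∧ 2 ≤ N)
    (hρ : IsHolonomyLift ρ ∨ IsParabolic ρ) : IsParabolic ρ := by
  refine hρ.elim (fun hol => ⟨hol.isNonabelian (exists_not_commute h), ?_⟩) id
  have htr := hol.trace_sq_eq_four (commute_longitude k N) (abel k N) abel_proj_fa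
    (abel_longitude k N) (fun j => longitude_pow_ne_one h)
  rw [show (4 : ℂ) = 2 ^ 2 by norm_num] at htr
  exact sq_eq_sq_iff_eq_or_eq_neg.1 htr

end Discrete

end DoubleTwist

end

theorem proposition3p6 (n : ℤ) (hn : 1 ≤ n) :
    (∀ m : ℕ, 1 ≤ m → ∀ ρ : DoubleTwist.KnotGroup (2 * m) n →* Matrix.SpecialLinearGroup (Fin 2) ℂ,
      DoubleTwist.IsHolonomyLift ρ ∨ DoubleTwist.IsParabolic ρ →
      DoubleTwist.HasExtremeTerms (DoubleTwist.adjointAlexander ρ)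
        0 (-((m : ℂ) * (n : ℂ) * DoubleTwist.chebS ((m : ℤ) - 1) (DoubleTwist.trY ρ) ^ 2 *
          DoubleTwist.chebS (n - 1) (DoubleTwist.trZ ρ) ^ 2))
        (-3) ((m : ℂ) * (n : ℂ) * DoubleTwist.chebS ((m : ℤ) - 1) (DoubleTwist.trY ρ) ^ 2 *
          DoubleTwist.chebS (n - 1) (DoubleTwist.trZ ρ) ^ 2)) ∧
    (∀ m : ℕ, 1 ≤ m →
      ∀ ρ : DoubleTwist.KnotGroup (2 * m + 1) n →* Matrix.SpecialLinearGroup (Fin 2) ℂ,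
      DoubleTwist.IsHolonomyLift ρ ∨ DoubleTwist.IsParabolic ρ →
      DoubleTwist.HasExtremeTerms (DoubleTwist.adjointAlexander ρ)
        (6 * n - 3) ((m : ℂ) * DoubleTwist.chebS ((m : ℤ) - 1) (DoubleTwist.trY ρ) ^ 2)
        0 (-((m : ℂ) * DoubleTwist.chebS ((m : ℤ) - 1) (DoubleTwist.trY ρ) ^ 2))) ∧
    (2 ≤ n → ∀ ρ : DoubleTwist.KnotGroup 1 n →* Matrix.SpecialLinearGroup (Fin 2) ℂ,
      DoubleTwist.IsHolonomyLift ρ ∨ DoubleTwist.IsParabolic ρ →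
      DoubleTwist.HasExtremeTerms (DoubleTwist.adjointAlexander ρ) (6 * n - 6) (-1) 3 1) := by
  obtain ⟨N, rfl⟩ := Int.eq_ofNat_of_zero_le (zero_le_one.trans hn)
  have hN : N ≠ 0 := by omega
  refine ⟨fun m hm ρ hρ => ?_, fun m hm ρ hρ => ?_, fun hN2 ρ hρ => ?_⟩
  · have hm0 : m ≠ 0 := Nat.ne_of_gt hm
    have hpar := DoubleTwist.isParabolic_of_isHolonomyLift_or (Or.inl ⟨by omega, hN⟩) hρ
    have h := DoubleTwist.hasExtremeTerms_even ρ hm0 hN hpar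
    rwa [← Int.cast_natCast (R := ℂ) N] at h
  · have hm0 : m ≠ 0 := Nat.ne_of_gt hm
    have hpar := DoubleTwist.isParabolic_of_isHolonomyLift_or (Or.inl ⟨by omega, hN⟩) hρ
    obtain ⟨M, rfl⟩ := Nat.exists_eq_succ_of_ne_zero hN
    convert DoubleTwist.hasExtremeTerms_odd ρ hm0 hpar using 1
    push_cast
    ring
  · have hpar := DoubleTwist.isParabolic_of_isHolonomyLift_or (Or.inr ⟨rfl, by omega⟩) hρ
    obtain ⟨M, rfl⟩ := Nat.exists_eq_add_of_le' (show 2 ≤ N by omega)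
    convert DoubleTwist.hasExtremeTerms_one ρ hpar using 1
    push_cast
    ring
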